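/- Let $d\in\{2,3\}$ and let $\Omega\subset\mathbb R^d$ be a bounded polygonal/polyhedral domain with outward unit normal $n$, triangulated by a conforming simplicial mesh $\mathcal T_h$, i.e. $\overline\Omega$ is the union of the finitely many closed simplices $K\in\mathcal T_h$ (and $\Omega$ is the interior of this union), any two of which meet in a common face or not at all. Write $h_K=\operatorname{diam}K$, $h=\max_K h_K$, $h_F=\operatorname{diam}F$ for a $(d-1)$-dimensional face $F$, $\mathcal F_{int}$ for the set of interior faces, $(\cdot,\cdot)$ for the $L^2(\Omega)$ and $\langle\cdot,\cdot\rangle_{\partial\Omega}$ for the $L^2(\partial\Omega)$ scalar product, $[\![\cdot]\!]$ for the jump over a face, and $(t)_\pm=\tfrac12(t\pm|t|)$. Let $\mu>0$, $\beta\in[C^2(\overline\Omega)]^d$, $c\in C^1(\overline\Omega)$, and let $V_h=W_h$ be the space $X_h^1$ of continuous functions on $\overline\Omega$ that are affine on every $K\in\mathcal T_h$. Define $$a(u,v)=(\mu\nabla u,\nabla v)+(\nabla\cdot(\beta u)+cu,v),$$ $$a_h(u,v)=a(u,v)-\theta\langle\nabla u\cdot n,v\rangle_{\partial\Omega}-\theta\langle\nabla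 v\cdot n,u\rangle_{\partial\Omega}-\langle(\beta\cdot n)_-u,v\rangle_{\partial\Omega},$$ where $\theta$ is any real number (in particular $\theta=1$, or the consistent choice $\theta=\mu$), and $$s_{cip}(u,v)=\sum_{F\in\mathcal F_{int}}\int_F\big(h_F\gamma_{1,F}[\![\nabla u]\!]\cdot[\![\nabla v]\!]+h_F^3\gamma_{2,F}[\![\Delta u]\!][\![\Delta v]\!]\big)\,ds,$$ $$s_{bc}^{\pm}(u,v)=\langle\mu h^{-1}u,v\rangle_{\partial\Omega}+\langle|(\beta\cdot n)_\pm|u,v\rangle_{\partial\Omega},\qquad s_p=s_{cip}+s_{bc}^-,\qquad s_a=s_{cip}+s_{bc}^+,$$ where derivatives are taken elementwise. Assume that, with positive constants and for all $F\in\mathcal F_{int}$, $\gamma_{1,F}\sim\mu+\|\beta_h\cdot n_F\|_{\infty,F}\,h_F$ and $\gamma_{2,F}\sim\mu$, where $n_F$ is a unit normal to $F$, $\beta_h$ is the piecewise affine nodal interpolant of $\beta$, and $x\sim y$ means two-sided bounds $m\,y\le x\le M\,y$ with constants $m,M>0$ independent of $F$. Then for every $f\in L^2(\Omega)$ and every function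 $u$ on $\overline\Omega$ that is $C^2$ on each closed element (for example a sufficiently regular exact solution of the continuous problem), there is exactly one pair $(u_h,z_h)\in V_h\times W_h$ such that $$a_h(u_h,w_h)+s_a(z_h,w_h)=(f,w_h)\quad\text{and}\quad a_h(v_h,z_h)-s_p(u_h,v_h)=-s_p(u,v_h)$$ for all $v_h\in V_h$ and $w_h\in W_h$. The same holds if $s_p(u,\cdot)$ on the right-hand side is replaced by an arbitrary linear functional on $V_h$. -/

import Mathlib

open scoped InnerProductSpace MeasureTheory

noncomputable section

namespace NonCoerciveFEM

/-- The Euclidean space `ℝ^d`. -/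
abbrev E (d : ℕ) : Type := EuclideanSpace ℝ (Fin d)

/-- A (conforming) triangulation of a bounded polygonal / polyhedral domain of `ℝ^d`: a finite,
nonempty simplicial complex in which every simplex is a face of a `d`-dimensional simplex.
Simplices are given by their finite vertex sets. -/
structure Triangulation (d : ℕ) where
  complex : Geometry.SimplicialComplex ℝ (E d)
  finite : complex.faces.Finite
  nonempty : complex.faces.Nonempty
  pure : ∀ s ∈ complex.faces, ∃ t ∈ complex.faces, s ⊆ t ∧ t.card = d + 1

/-- The closed simplex spanned by a finite set of vertices. -/
def simplex {d : ℕ} (s : Finset (E d)) : Set (E d) := convexHull ℝ (s : Set (E d))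

/-- The diameter of the simplex `s` (`h_K` for an element, `h_F` for a face). -/
def diam {d : ℕ} (s : Finset (E d)) : ℝ := Metric.diam (simplex s)

/-- The barycentre of the simplex `s`. -/
def barycentre {d : ℕ} (s : Finset (E d)) : E d := (s.card : ℝ)⁻¹ • ∑ v ∈ s, v

/-- The unit normal to the face `F` of the element `K`, pointing out of `K`: the normalised
component orthogonal to `F` of the vector from the barycentre of `K` to that of `F`. -/
def normal {d : ℕ} (K F : Finset (E d)) : E d :=
  let w := (vectorSpan ℝ (F : Set (E d)))ᗮ.starProjection (barycentre F - barycentre K)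
  ‖w‖⁻¹ • w

/-- The surface integral of `g` over the `(d-1)`-dimensional simplex `F`. -/
def faceIntegral {d : ℕ} (F : Finset (E d)) (g : E d → ℝ) : ℝ :=
  ∫ x in simplex F, g x ∂μHE[d - 1]

/-- The gradient of `u` restricted to the closed element `K`; at points of a face of `K` this is
the trace of the gradient taken from `K`. -/
def gradOn {d : ℕ} (K : Finset (E d)) (u : E d → ℝ) (x : E d) : E d :=
  gradientWithin u (simplex K) x

/-- The Laplacian of `u` restricted to the closed element `K`. -/
def lapOn {d : ℕ} (K : Finset (E d)) (u : E d → ℝ) (x : E d) : ℝ :=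
  InnerProductSpace.laplacianWithin u (simplex K) x

/-- The divergence of the vector field `g` restricted to the closed element `K`. -/
def divOn {d : ℕ} (K : Finset (E d)) (g : E d → E d) (x : E d) : ℝ :=
  ∑ i : Fin d, (fderivWithin ℝ g (simplex K) x (EuclideanSpace.single i 1)) i

/-- Positive part `(t)_+ = (t + |t|) / 2`. -/
def pos (t : ℝ) : ℝ := (t + |t|) / 2

/-- Negative part, with its sign, `(t)_- = (t - |t|) / 2`. -/
def neg (t : ℝ) : ℝ := (t - |t|) / 2

/-- `‖β_h · n‖_{∞,F}`, where `β_h` is the piecewise affine nodal interpolant of `β`: at the point of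
`F` with barycentric coordinates `w` it takes the value `∑ w_v β(v)`. -/
def interpNormalSup {d : ℕ} (β : E d → E d) (F : Finset (E d)) (n : E d) : ℝ :=
  ⨆ w : stdSimplex ℝ F, |⟪∑ v : F, (w : F → ℝ) v • β v, n⟫_ℝ|

namespace Triangulation

variable {d : ℕ} (T : Triangulation d)

/-- The closure `Ω̄` of the domain: the union of all closed simplices. -/
def closedDomain : Set (E d) := T.complex.space

/-- The domain `Ω`. -/
def domain : Set (E d) := interior T.closedDomain

/-- `Ω̄` is indeed the closure of `Ω`. -/
theorem closure_domain : closure T.domain = T.closedDomain := by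
  have hcl : IsClosed T.closedDomain := by
    unfold closedDomain Geometry.SimplicialComplex.space
    exact T.finite.isClosed_biUnion fun s _ => (s.finite_toSet.isCompact_convexHull ℝ).isClosed
  apply subset_antisymm
  · exact closure_minimal interior_subset hcl
  · intro x hx
    obtain ⟨s, hs, hxs⟩ := Geometry.SimplicialComplex.mem_space_iff.1 hx
    obtain ⟨t, ht, hst, hcard⟩ := T.pure s hs
    have hxt : x ∈ convexHull ℝ (t : Set (E d)) :=
      convexHull_mono (Finset.coe_subset.2 hst) hxs
    have hspan : affineSpan ℝ (t : Set (E d)) = ⊤ := by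
      have h := (T.complex.indep ht).affineSpan_eq_top_iff_card_eq_finrank_add_one.2
        (by simp [hcard])
      simpa using h
    have hne : (interior (convexHull ℝ (t : Set (E d)))).Nonempty :=
      interior_convexHull_nonempty_iff_affineSpan_eq_top.2 hspan
    have hc := (convex_convexHull ℝ (t : Set (E d))).closure_interior_eq_closure_of_nonempty_interior
      hne
    have hx' : x ∈ closure (interior (convexHull ℝ (t : Set (E d)))) := by
      rw [hc]; exact subset_closure hxt
    exact closure_mono
      (interior_mono (Geometry.SimplicialComplex.convexHull_subset_space ht)) hx'

open Classical in
/-- The elements: the simplices of full dimension. -/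
def elements : Finset (Finset (E d)) := T.finite.toFinset.filter fun s => s.card = d + 1

open Classical in
/-- The elements having `F` as a face. -/
def elementsAt (F : Finset (E d)) : Finset (Finset (E d)) := T.elements.filter fun K => F ⊆ K

open Classical in
/-- The `(d-1)`-dimensional faces shared by two elements. -/
def interiorFaces : Finset (Finset (E d)) :=
  T.finite.toFinset.filter fun F => F.card = d ∧ (T.elementsAt F).card = 2

open Classical in
/-- The `(d-1)`-dimensional faces belonging to one element only; their union is `∂Ω`. -/
def boundaryFaces : Finset (Finset (E d)) :=
  T.finite.toFinset.filter fun F => F.card = d ∧ (T.elementsAt F).card = 1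

/-- The mesh size `h`, the largest diameter of an element. -/
def meshSize : ℝ := sSup (diam '' (T.elements : Set (Finset (E d))))

/-- The finite element space `X_h^k` of continuous functions on `Ω̄` whose restriction to each
element is a polynomial of degree at most `k`. A function on `Ω̄` is represented by its extension
by zero to `ℝ^d`. -/
def feSpace (k : ℕ) : Submodule ℝ (E d → ℝ) where
  carrier := {v | (∀ x, x ∉ T.closedDomain → v x = 0) ∧ ContinuousOn v T.closedDomain ∧
    ∀ K ∈ T.elements, ∃ p : MvPolynomial (Fin d) ℝ, p.totalDegree ≤ k ∧
      ∀ x ∈ simplex K, v x = MvPolynomial.eval (fun i => x i) p}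
  zero_mem' := ⟨fun _ _ => rfl, continuousOn_const, fun _ _ => ⟨0, by simp, by simp⟩⟩
  add_mem' := by
    rintro v w ⟨hv, hvc, hvp⟩ ⟨hw, hwc, hwp⟩
    refine ⟨fun x hx => by simp [hv x hx, hw x hx], hvc.add hwc, fun K hK => ?_⟩
    obtain ⟨p, hp, hpe⟩ := hvp K hK
    obtain ⟨q, hq, hqe⟩ := hwp K hK
    exact ⟨p + q, (MvPolynomial.totalDegree_add p q).trans (max_le hp hq),
      fun x hx => by simp [hpe x hx, hqe x hx]⟩
  smul_mem' := by
    rintro r v ⟨hv, hvc, hvp⟩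
    refine ⟨fun x hx => by simp [hv x hx], hvc.const_smul r, fun K hK => ?_⟩
    obtain ⟨p, hp, hpe⟩ := hvp K hK
    exact ⟨r • p, (MvPolynomial.totalDegree_smul_le r p).trans hp,
      fun x hx => by simp [hpe x hx, MvPolynomial.smul_eval]⟩

/-- The `L²(∂Ω)`-type integral of a function which may depend on the element `K` from which the
trace is taken and on the boundary face `F` (for instance through the outward normal). -/
def boundaryIntegral (g : Finset (E d) → Finset (E d) → E d → ℝ) : ℝ :=
  ∑ F ∈ T.boundaryFaces, ∑ K ∈ T.elementsAt F, faceIntegral F (g K F)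

/-- `a(u,v) = (μ ∇u, ∇v) + (∇·(β u) + c u, v)`; the integrals over `Ω` are written as sums over the
elements. -/
def a (μ : ℝ) (β : E d → E d) (c : E d → ℝ) (u v : E d → ℝ) : ℝ :=
  (∑ K ∈ T.elements, ∫ x in simplex K, μ * ⟪gradOn K u x, gradOn K v x⟫_ℝ) +
  ∑ K ∈ T.elements, ∫ x in simplex K, (divOn K (fun y => u y • β y) x + c x * u x) * v x

/-- The discrete bilinear form with weakly imposed Dirichlet condition,
`a(u,v) - θ ⟨∇u·n, v⟩_{∂Ω} - θ ⟨∇v·n, u⟩_{∂Ω} - ⟨(β·n)_- u, v⟩_{∂Ω}`. -/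
def ah (μ : ℝ) (β : E d → E d) (c : E d → ℝ) (θ : ℝ) (u v : E d → ℝ) : ℝ :=
  T.a μ β c u v
    - θ * T.boundaryIntegral (fun K F x => ⟪gradOn K u x, normal K F⟫_ℝ * v x)
    - θ * T.boundaryIntegral (fun K F x => ⟪gradOn K v x, normal K F⟫_ℝ * u x)
    - T.boundaryIntegral (fun K F x => neg ⟪β x, normal K F⟫_ℝ * u x * v x)

/-- The product `⟦∇u⟧ · ⟦∇v⟧` of the jumps of the gradients over the interior face `F`. The sum runs
over ordered pairs of elements at `F`, so both orientations of the jump contribute (equally). -/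
def gradJumpProd (F : Finset (E d)) (u v : E d → ℝ) (x : E d) : ℝ :=
  (1 / 2) * ∑ K ∈ T.elementsAt F, ∑ K' ∈ T.elementsAt F,
    ⟪gradOn K u x - gradOn K' u x, gradOn K v x - gradOn K' v x⟫_ℝ

/-- The product `⟦Δu⟧ ⟦Δv⟧` of the jumps of the Laplacians over the interior face `F`. -/
def lapJumpProd (F : Finset (E d)) (u v : E d → ℝ) (x : E d) : ℝ :=
  (1 / 2) * ∑ K ∈ T.elementsAt F, ∑ K' ∈ T.elementsAt F,
    (lapOn K u x - lapOn K' u x) * (lapOn K v x - lapOn K' v x)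

/-- The continuous interior penalty stabilisation. -/
def scip (γ₁ γ₂ : Finset (E d) → ℝ) (u v : E d → ℝ) : ℝ :=
  ∑ F ∈ T.interiorFaces, faceIntegral F fun x =>
    diam F * γ₁ F * T.gradJumpProd F u v x + diam F ^ 3 * γ₂ F * T.lapJumpProd F u v x

/-- The boundary stabilisation `⟨μ h⁻¹ u, v⟩_{∂Ω} + ⟨|σ(β·n)| u, v⟩_{∂Ω}`, where `σ` is
`(·)_+` or `(·)_-`. -/
def sbc (σ : ℝ → ℝ) (μ : ℝ) (β : E d → E d) (u v : E d → ℝ) : ℝ :=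
  T.boundaryIntegral (fun _ _ x => μ * T.meshSize⁻¹ * u x * v x) +
  T.boundaryIntegral (fun K F x => |σ ⟪β x, normal K F⟫_ℝ| * u x * v x)

/-- The stabilisation `s_p` of the primal equation. -/
def sp (μ : ℝ) (β : E d → E d) (γ₁ γ₂ : Finset (E d) → ℝ) (u v : E d → ℝ) : ℝ :=
  T.scip γ₁ γ₂ u v + T.sbc neg μ β u v

/-- The stabilisation `s_a` of the adjoint equation. -/
def sa (μ : ℝ) (β : E d → E d) (γ₁ γ₂ : Finset (E d) → ℝ) (u v : E d → ℝ) : ℝ :=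
  T.scip γ₁ γ₂ u v + T.sbc pos μ β u v

/-- `γ₁,F ∼ μ + ‖β_h·n_F‖_{∞,F} h_F` and `γ₂,F ∼ μ` on the interior faces, `∼` meaning two-sided
bounds with positive constants. (The reference value does not depend on the orientation of `n_F`,
so it may be computed from either element at `F`.) -/
def AdmissibleParameters (μ : ℝ) (β : E d → E d) (γ₁ γ₂ : Finset (E d) → ℝ) : Prop :=
  (∃ m M : ℝ, 0 < m ∧ 0 < M ∧ ∀ F ∈ T.interiorFaces, ∀ K ∈ T.elementsAt F,
    m * (μ + interpNormalSup β F (normal K F) * diam F) ≤ γ₁ F ∧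
    γ₁ F ≤ M * (μ + interpNormalSup β F (normal K F) * diam F)) ∧
  ∃ m M : ℝ, 0 < m ∧ 0 < M ∧ ∀ F ∈ T.interiorFaces, m * μ ≤ γ₂ F ∧ γ₂ F ≤ M * μ

/-- `(uh, zh)` solves the finite element formulation with `V_h = W_h = X_h^k`, source `f`, and
right-hand side `-ℓ(v_h)` in the second equation. -/
def IsFEMSolution (k : ℕ) (μ : ℝ) (β : E d → E d) (c : E d → ℝ) (θ : ℝ)
    (γ₁ γ₂ : Finset (E d) → ℝ) (f : E d → ℝ) (ℓ : T.feSpace k → ℝ)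
    (uh zh : T.feSpace k) : Prop :=
  (∀ wh : T.feSpace k,
    T.ah μ β c θ uh wh + T.sa μ β γ₁ γ₂ zh wh = ∫ x in T.domain, f x * wh.1 x) ∧
  ∀ vh : T.feSpace k, T.ah μ β c θ vh zh - T.sp μ β γ₁ γ₂ uh vh = -ℓ vh

end Triangulation

end NonCoerciveFEM

end

/-!
Testing the first equation with `z_h` and the second with `u_h` cancels `a_h` and leaves
`s_p(u_h, u_h) + s_a(z_h, z_h) = 0` for the homogeneous system, so that everything rests on the
definiteness of the stabilisations on `X_h^1`. There the Laplacians vanish, so if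
`s(u, u) = 0` then `u` has no gradient jump across the interior faces and vanishes on the boundary
faces. Start at an interior point `x` of an element and follow a ray along which `|u|` does not
decrease and which misses all faces of codimension at least two: `u` keeps the same affine
expression until the ray leaves the domain, necessarily through a boundary face, where `u = 0`.
Hence `u x = 0`.
-/

namespace NonCoerciveFEM

open MeasureTheory Measure Module Set Filter Topology

section PrimalDual

variable {𝕜 V W : Type*} [Field 𝕜] [LinearOrder 𝕜] [IsStrictOrderedRing 𝕜]
  [AddCommGroup V] [Module 𝕜 V] [FiniteDimensional 𝕜 V]
  [AddCommGroup W] [Module 𝕜 W] [FiniteDimensional 𝕜 W]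

theorem existsUnique_primalDual (A : V →ₗ[𝕜] W →ₗ[𝕜] 𝕜) {P : V →ₗ[𝕜] V →ₗ[𝕜] 𝕜}
    {Q : W →ₗ[𝕜] W →ₗ[𝕜] 𝕜} (hP : ∀ u ≠ 0, 0 < P u u) (hQ : ∀ z ≠ 0, 0 < Q z z)
    (φ : W →ₗ[𝕜] 𝕜) (ψ : V →ₗ[𝕜] 𝕜) :
    ∃! p : V × W, (∀ w, A p.1 w + Q p.2 w = φ w) ∧ ∀ v, A v p.2 - P p.1 v = ψ v := by
  let Φ : V × W →ₗ[𝕜] Dual 𝕜 W × Dual 𝕜 V := (A.coprod Q).prod ((-P).coprod A.flip)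
  have hΦ : ∀ p, Φ p = (φ, ψ) ↔
      (∀ w, A p.1 w + Q p.2 w = φ w) ∧ ∀ v, A v p.2 - P p.1 v = ψ v := fun p => by
    simp [Φ, Prod.ext_iff, LinearMap.ext_iff, neg_add_eq_sub]
  have hP0 : ∀ u, 0 ≤ P u u := fun u => by
    obtain rfl | hu := eq_or_ne u 0
    exacts [by simp, (hP u hu).le]
  have hQ0 : ∀ z, 0 ≤ Q z z := fun z => by
    obtain rfl | hz := eq_or_ne z 0
    exacts [by simp, (hQ z hz).le]
  have hker : LinearMap.ker Φ = ⊥ := by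
    refine LinearMap.ker_eq_bot'.2 fun ⟨u, z⟩ h => ?_
    have h₁ : A u z + Q z z = 0 := LinearMap.congr_fun (congrArg Prod.fst h) z
    have h₂ : -P u u + A u z = 0 := LinearMap.congr_fun (congrArg Prod.snd h) u
    have hu : u = 0 := by_contra fun hu => by linarith [hP u hu, hQ0 z]
    have hz : z = 0 := by_contra fun hz => by linarith [hQ z hz, hP0 u]
    rw [hu, hz, Prod.mk_zero_zero]
  have hdim : finrank 𝕜 (V × W) = finrank 𝕜 (Dual 𝕜 W × Dual 𝕜 V) := by
    simp [Subspace.dual_finrank_eq, add_comm]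
  have hinj : Function.Injective Φ := LinearMap.ker_eq_bot.1 hker
  have hbij : Function.Bijective Φ :=
    ⟨hinj, (LinearMap.injective_iff_surjective_of_finrank_eq_finrank hdim).1 hinj⟩
  exact (existsUnique_congr hΦ).1 (hbij.existsUnique (φ, ψ))

end PrimalDual

section ConvexMeasure

variable {V : Type*} [NormedAddCommGroup V] [InnerProductSpace ℝ V] [FiniteDimensional ℝ V]
  {s : Set V} {p : V}

theorem subset_closure_interior_preimage_vectorSpan_add (hs : Convex ℝ s) (hp : p ∈ s) :
    (fun v : vectorSpan ℝ s => (v : V) + p) ⁻¹' s ⊆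
      closure (interior ((fun v : vectorSpan ℝ s => (v : V) + p) ⁻¹' s)) := by
  set U := (fun v : vectorSpan ℝ s => (v : V) + p) ⁻¹' s with hU
  have hconv : Convex ℝ U := (hs.translate_preimage_left p).linear_preimage (Submodule.subtype _)
  have h0 : (0 : vectorSpan ℝ s) ∈ U := by simpa [hU] using hp
  have hspan : Submodule.span ℝ U = ⊤ := by
    have hmap : (vectorSpan ℝ s).subtype '' U = (· -ᵥ p) '' s := by
      ext y
      constructor
      · rintro ⟨v, hv, rfl⟩
        exact ⟨_, hv, by simp⟩
      · rintro ⟨x, hx, rfl⟩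
        exact ⟨⟨x - p, vsub_mem_vectorSpan ℝ hx hp⟩, by simpa [hU] using hx, rfl⟩
    refine Submodule.map_injective_of_injective (vectorSpan ℝ s).injective_subtype ?_
    rw [Submodule.map_span, hmap, ← vectorSpan_eq_span_vsub_set_right ℝ hp,
      Submodule.map_subtype_top]
  have hint : (interior U).Nonempty := by
    rw [hconv.interior_nonempty_iff_affineSpan_eq_top,
      AffineSubspace.affineSpan_eq_top_iff_vectorSpan_eq_top_of_nonempty ℝ _ _ ⟨0, h0⟩,
      vectorSpan_eq_span_vsub_set_right ℝ h0]
    simpa using hspan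
  rw [hconv.closure_interior_eq_closure_of_nonempty_interior hint]
  exact subset_closure

variable [MeasurableSpace V] [BorelSpace V] {n : ℕ}

theorem map_volume_submodule_add (W : Submodule ℝ V) (p : V) :
    (volume : Measure W).map (fun v : W => (v : V) + p) =
      (μHE[finrank ℝ W] : Measure V).restrict (range fun v : W => (v : V) + p) := by
  have hφ : Isometry fun v : W => (v : V) + p :=
    (IsometryEquiv.addRight p).isometry.comp isometry_subtype_coe
  rw [← InnerProductSpace.euclideanHausdorffMeasure_eq_volume, hφ.map_euclideanHausdorffMeasure]

theorem measurePreserving_vectorSpan_add (hs : MeasurableSet s) (hp : p ∈ s) :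
    MeasurePreserving (fun v : vectorSpan ℝ s => (v : V) + p)
      (volume.restrict ((fun v : vectorSpan ℝ s => (v : V) + p) ⁻¹' s))
      ((μHE[finrank ℝ (vectorSpan ℝ s)] : Measure V).restrict s) := by
  have hφ : Continuous fun v : vectorSpan ℝ s => (v : V) + p := by fun_prop
  have hrange : s ⊆ range fun v : vectorSpan ℝ s => (v : V) + p := fun x hx =>
    ⟨⟨x - p, vsub_mem_vectorSpan ℝ hx hp⟩, sub_add_cancel x p⟩
  refine ⟨hφ.measurable, ?_⟩
  rw [← restrict_map hφ.measurable hs, map_volume_submodule_add, restrict_restrict hs,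
    inter_eq_left.2 hrange]

theorem euclideanHausdorffMeasure_lt_top (hs : IsCompact s)
    (hn : finrank ℝ (vectorSpan ℝ s) = n) : (μHE[n] : Measure V) s < ⊤ := by
  subst hn
  obtain rfl | ⟨p, hp⟩ := s.eq_empty_or_nonempty
  · simp
  have hφ : IsClosedEmbedding fun v : vectorSpan ℝ s => (v : V) + p :=
    (Homeomorph.addRight p).isClosedEmbedding.comp
      (vectorSpan ℝ s).closed_of_finiteDimensional.isClosedEmbedding_subtypeVal
  have h := (measurePreserving_vectorSpan_add hs.measurableSet hp).measure_preimage
    hs.measurableSet.nullMeasurableSet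
  rw [restrict_apply_self, restrict_apply_self] at h
  rw [← h]
  exact (hφ.isCompact_preimage hs).measure_lt_top

theorem eqOn_zero_of_setIntegral_euclideanHausdorffMeasure_eq_zero (hs : Convex ℝ s)
    (hc : IsCompact s) (hn : finrank ℝ (vectorSpan ℝ s) = n) {g : V → ℝ} (hg : ContinuousOn g s)
    (hg0 : ∀ x ∈ s, 0 ≤ g x) (hint : ∫ x in s, g x ∂(μHE[n] : Measure V) = 0) : EqOn g 0 s := by
  intro x hx
  have hgs : IntegrableOn g s (μHE[n] : Measure V) :=
    hg.integrableOn_of_subset_isCompact hc hc.measurableSet subset_rfl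
      (euclideanHausdorffMeasure_lt_top hc hn).ne
  rw [setIntegral_eq_zero_iff_of_nonneg_ae ((ae_restrict_mem hc.measurableSet).mono hg0) hgs]
    at hint
  subst hn
  have hae := (measurePreserving_vectorSpan_add hc.measurableSet hx).quasiMeasurePreserving.ae
    hint
  have hφ : Continuous fun v : vectorSpan ℝ s => (v : V) + x := by fun_prop
  have hzero := eqOn_of_ae_eq hae (hg.comp hφ.continuousOn (mapsTo_preimage _ _))
    continuousOn_const (subset_closure_interior_preimage_vectorSpan_add hs hx)
    (show (0 : vectorSpan ℝ s) ∈ _ by simpa using hx)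
  simpa using hzero

end ConvexMeasure

variable {d : ℕ}

section Simplex

variable {s t F : Finset (E d)}

theorem isCompact_simplex (s : Finset (E d)) : IsCompact (simplex s) :=
  s.finite_toSet.isCompact_convexHull ℝ

theorem convex_simplex (s : Finset (E d)) : Convex ℝ (simplex s) :=
  convex_convexHull ℝ _

theorem subset_simplex (s : Finset (E d)) : (s : Set (E d)) ⊆ simplex s :=
  subset_convexHull ℝ _

theorem simplex_mono (h : s ⊆ t) : simplex s ⊆ simplex t :=
  convexHull_mono (Finset.coe_subset.2 h)

theorem diam_nonneg (s : Finset (E d)) : 0 ≤ diam s :=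
  Metric.diam_nonneg

theorem diam_pos_of_one_lt_card (hs : 1 < s.card) : 0 < diam s := by
  obtain ⟨x, hx, y, hy, hxy⟩ := Finset.one_lt_card.1 hs
  exact (dist_pos.2 hxy).trans_le (Metric.dist_le_diam_of_mem (isCompact_simplex s).isBounded
    (subset_simplex s hx) (subset_simplex s hy))

theorem finrank_vectorSpan_simplex (hs : AffineIndependent ℝ ((↑) : s → E d)) (hne : s.Nonempty) :
    finrank ℝ (vectorSpan ℝ (simplex s)) = s.card - 1 := by
  have h := hs.finrank_vectorSpan (n := s.card - 1) (by
    rw [Fintype.card_coe, Nat.sub_add_cancel hne.card_pos])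
  have hspan : vectorSpan ℝ (simplex s) = vectorSpan ℝ (range ((↑) : s → E d)) := by
    rw [simplex, ← direction_affineSpan, affineSpan_convexHull, direction_affineSpan,
      Subtype.range_coe_subtype, Finset.setOfPred_mem]
  rwa [hspan]

theorem faceIntegral_nonneg {g : E d → ℝ} (hg : ∀ x ∈ simplex F, 0 ≤ g x) : 0 ≤ faceIntegral F g :=
  setIntegral_nonneg (isCompact_simplex F).measurableSet hg

theorem faceIntegral_congr {g g' : E d → ℝ} (h : EqOn g g' (simplex F)) :
    faceIntegral F g = faceIntegral F g' :=
  setIntegral_congr_fun (isCompact_simplex F).measurableSet h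

end Simplex

theorem exists_eval_eq_inner_add {p : MvPolynomial (Fin d) ℝ} (hp : p.totalDegree ≤ 1) :
    ∃ (g : E d) (b : ℝ), ∀ x : E d, p.eval (fun i => x i) = ⟪g, x⟫_ℝ + b := by
  rw [p.as_sum]
  refine Finset.sum_induction _ (fun q : MvPolynomial (Fin d) ℝ =>
    ∃ (g : E d) (b : ℝ), ∀ x : E d, q.eval (fun i => x i) = ⟪g, x⟫_ℝ + b) ?_ ?_ ?_
  · rintro q q' ⟨g, b, hq⟩ ⟨g', b', hq'⟩
    exact ⟨g + g', b + b', fun x => by rw [map_add, hq, hq', inner_add_left]; ring⟩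
  · exact ⟨0, 0, fun x => by simp⟩
  · intro m hm
    obtain hm₀ | hm₁ : (m.sum fun _ n => n) = 0 ∨ (m.sum fun _ n => n) = 1 := by
      have := (MvPolynomial.le_totalDegree hm).trans hp
      lia
    · obtain rfl : m = 0 := Finsupp.ext (by simpa [Finsupp.sum_fintype] using hm₀)
      exact ⟨0, p.coeff 0, fun x => by simp⟩
    · obtain ⟨i, rfl⟩ := (Finsupp.sum_eq_one_iff m).1 hm₁
      exact ⟨p.coeff (Finsupp.single i 1) • EuclideanSpace.single i 1, 0, fun x => by
        simp [MvPolynomial.eval_monomial, real_inner_smul_left, EuclideanSpace.inner_single_left]⟩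

section AffineOnElement

variable {K : Finset (E d)} {u : E d → ℝ} {g : E d} {b : ℝ} {x : E d}

theorem fderivWithin_of_eqOn_inner_add (hK : UniqueDiffOn ℝ (simplex K))
    (hu : EqOn u (fun y => ⟪g, y⟫_ℝ + b) (simplex K)) (hx : x ∈ simplex K) :
    fderivWithin ℝ u (simplex K) x = innerSL ℝ g :=
  (((innerSL ℝ g).hasFDerivWithinAt.add_const b).congr hu (hu hx)).fderivWithin (hK x hx)

theorem gradOn_of_eqOn_inner_add (hK : UniqueDiffOn ℝ (simplex K))
    (hu : EqOn u (fun y => ⟪g, y⟫_ℝ + b) (simplex K)) (hx : x ∈ simplex K) : gradOn K u x = g := by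
  rw [gradOn, gradientWithin, fderivWithin_of_eqOn_inner_add hK hu hx]
  exact (InnerProductSpace.toDual ℝ (E d)).symm_apply_apply g

theorem lapOn_of_eqOn_inner_add (hK : UniqueDiffOn ℝ (simplex K))
    (hu : EqOn u (fun y => ⟪g, y⟫_ℝ + b) (simplex K)) (hx : x ∈ simplex K) : lapOn K u x = 0 := by
  rw [lapOn, InnerProductSpace.laplacianWithin_eq_iteratedFDerivWithin_stdOrthonormalBasis u hK hx]
  refine Finset.sum_eq_zero fun i _ => ?_
  rw [iteratedFDerivWithin_two_apply u hK hx,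
    fderivWithin_congr (fun y hy => fderivWithin_of_eqOn_inner_add hK hu hy)
      (fderivWithin_of_eqOn_inner_add hK hu hx)]
  simp

end AffineOnElement

namespace Triangulation

variable {T : Triangulation d} {K F s : Finset (E d)}

theorem mem_elements : K ∈ T.elements ↔ K ∈ T.complex.faces ∧ K.card = d + 1 := by
  simp [elements]

theorem mem_elementsAt : K ∈ T.elementsAt F ↔ K ∈ T.elements ∧ F ⊆ K := by
  simp [elementsAt]

theorem mem_interiorFaces :
    F ∈ T.interiorFaces ↔ F ∈ T.complex.faces ∧ F.card = d ∧ (T.elementsAt F).card = 2 := by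
  simp [interiorFaces]

theorem mem_boundaryFaces :
    F ∈ T.boundaryFaces ↔ F ∈ T.complex.faces ∧ F.card = d ∧ (T.elementsAt F).card = 1 := by
  simp [boundaryFaces]

theorem simplex_subset_of_mem_elementsAt (hK : K ∈ T.elementsAt F) : simplex F ⊆ simplex K :=
  simplex_mono (mem_elementsAt.1 hK).2

theorem isCompact_closedDomain (T : Triangulation d) : IsCompact T.closedDomain :=
  T.finite.isCompact_biUnion fun s _ => isCompact_simplex s

theorem simplex_subset_closedDomain (hs : s ∈ T.complex.faces) : simplex s ⊆ T.closedDomain :=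
  T.complex.convexHull_subset_space hs

theorem exists_mem_elements_superset (hs : s ∈ T.complex.faces) : ∃ K ∈ T.elements, s ⊆ K := by
  obtain ⟨K, hK, hsK, hcard⟩ := T.pure s hs
  exact ⟨K, mem_elements.2 ⟨hK, hcard⟩, hsK⟩

theorem exists_mem_simplex_of_mem_closedDomain {x : E d} (hx : x ∈ T.closedDomain) :
    ∃ K ∈ T.elements, x ∈ simplex K := by
  obtain ⟨s, hs, hxs⟩ := Geometry.SimplicialComplex.mem_space_iff.1 hx
  obtain ⟨K, hK, hsK⟩ := exists_mem_elements_superset hs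
  exact ⟨K, hK, simplex_mono hsK hxs⟩

theorem card_elementsAt_pos (hF : F ∈ T.complex.faces) : 0 < (T.elementsAt F).card := by
  obtain ⟨K, hK, hFK⟩ := exists_mem_elements_superset hF
  exact Finset.card_pos.2 ⟨K, mem_elementsAt.2 ⟨hK, hFK⟩⟩

/-- The vertices of an element, as an affine basis of `ℝ^d`; its coordinates are the barycentric
coordinates of the element. -/
def vertexBasis (hK : K ∈ T.elements) : AffineBasis K ℝ (E d) :=
  ⟨(↑), T.complex.indep (mem_elements.1 hK).1,
    (T.complex.indep (mem_elements.1 hK).1).affineSpan_eq_top_iff_card_eq_finrank_add_one.2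
      (by simp [(mem_elements.1 hK).2])⟩

theorem range_vertexBasis (hK : K ∈ T.elements) : range (vertexBasis hK) = (K : Set (E d)) :=
  Subtype.range_coe

theorem mem_simplex_iff_coord_nonneg (hK : K ∈ T.elements) {x : E d} :
    x ∈ simplex K ↔ ∀ v, 0 ≤ (vertexBasis hK).coord v x := by
  rw [simplex, ← range_vertexBasis hK, (vertexBasis hK).convexHull_eq_nonneg_coord]
  rfl

theorem mem_interior_simplex_iff_coord_pos (hK : K ∈ T.elements) {x : E d} :
    x ∈ interior (simplex K) ↔ ∀ v, 0 < (vertexBasis hK).coord v x := by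
  rw [simplex, ← range_vertexBasis hK, (vertexBasis hK).interior_convexHull]
  rfl

theorem interior_simplex_nonempty (hK : K ∈ T.elements) : (interior (simplex K)).Nonempty :=
  interior_convexHull_nonempty_iff_affineSpan_eq_top.2 (range_vertexBasis hK ▸ (vertexBasis hK).tot)

theorem closure_interior_simplex (hK : K ∈ T.elements) :
    closure (interior (simplex K)) = simplex K := by
  rw [(convex_simplex K).closure_interior_eq_closure_of_nonempty_interior
    (interior_simplex_nonempty hK), (isCompact_simplex K).isClosed.closure_eq]

theorem uniqueDiffOn_simplex (hK : K ∈ T.elements) : UniqueDiffOn ℝ (simplex K) :=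
  uniqueDiffOn_convex (convex_simplex K) (interior_simplex_nonempty hK)

/-- The functions that are `C²` on each closed element. -/
def piecewiseC2 (T : Triangulation d) : Submodule ℝ (E d → ℝ) where
  carrier := {v | ∀ K ∈ T.elements, ContDiffOn ℝ 2 v (simplex K)}
  zero_mem' := fun _ _ => contDiffOn_const
  add_mem' := fun hv hw K hK => (hv K hK).add (hw K hK)
  smul_mem' := fun _ _ hv K hK => contDiffOn_const.smul (hv K hK)

theorem feSpace_le_piecewiseC2 (T : Triangulation d) (k : ℕ) : T.feSpace k ≤ T.piecewiseC2 := by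
  intro v hv K hK
  obtain ⟨p, -, hp⟩ := hv.2.2 K hK
  have hpoly : ContDiff ℝ 2 fun x : E d => p.eval fun i => x i := by
    simp only [MvPolynomial.eval_eq]
    fun_prop
  exact hpoly.contDiffOn.congr hp

theorem exists_eqOn_inner_add (v : T.feSpace 1) (hK : K ∈ T.elements) :
    ∃ (g : E d) (b : ℝ), EqOn v.1 (fun x => ⟪g, x⟫_ℝ + b) (simplex K) := by
  obtain ⟨p, hp, hvp⟩ := v.2.2.2 K hK
  obtain ⟨g, b, hpg⟩ := exists_eval_eq_inner_add hp
  exact ⟨g, b, fun x hx => (hvp x hx).trans (hpg x)⟩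

theorem lapOn_feSpace (v : T.feSpace 1) (hK : K ∈ T.elements) {x : E d} (hx : x ∈ simplex K) :
    lapOn K v x = 0 := by
  obtain ⟨g, b, hv⟩ := exists_eqOn_inner_add v hK
  exact lapOn_of_eqOn_inner_add (uniqueDiffOn_simplex hK) hv hx

theorem feSpace_eq_zero_of_vertices {v : T.feSpace 1} (hv : ∀ K ∈ T.elements, ∀ a ∈ K, v.1 a = 0) :
    v = 0 := by
  ext x
  by_cases hx : x ∈ T.closedDomain
  · obtain ⟨K, hK, hxK⟩ := exists_mem_simplex_of_mem_closedDomain hx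
    obtain ⟨g, b, hg⟩ := exists_eqOn_inner_add v hK
    have hzero : simplex K ⊆ {y | ⟪g, y⟫_ℝ = -b} := by
      refine convexHull_min (fun a ha => ?_) (convex_hyperplane (innerₛₗ ℝ g).isLinear _)
      exact eq_neg_of_add_eq_zero_left ((hg (subset_simplex K ha)).symm.trans (hv K hK a ha))
    exact (hg hxK).trans (add_eq_zero_iff_eq_neg.2 (hzero hxK))
  · exact v.2.1 x hx

instance : FiniteDimensional ℝ (T.feSpace 1) := by
  let nodalValues : T.feSpace 1 →ₗ[ℝ] ((K : T.elements) → K.1 → ℝ) :=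
    { toFun := fun v _ a => v.1 a
      map_add' := fun _ _ => rfl
      map_smul' := fun _ _ => rfl }
  refine FiniteDimensional.of_injective nodalValues (LinearMap.ker_eq_bot.1 ?_)
  refine LinearMap.ker_eq_bot'.2 fun v hv => feSpace_eq_zero_of_vertices fun K hK a ha => ?_
  exact congrFun (congrFun hv ⟨K, hK⟩) ⟨a, ha⟩

end Triangulation

section BilinearFamilies

variable {V X W W' : Type*} [AddCommGroup V] [Module ℝ V] [TopologicalSpace X]
  [NormedAddCommGroup W] [NormedSpace ℝ W] [NormedAddCommGroup W'] [NormedSpace ℝ W']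
  {s t : Set X}

variable (V) in
/-- The real bilinear forms on `V`, as a subspace of all functions of two arguments; its closure
properties give the bilinearity of the forms built from integrals. -/
def bilinearForms : Submodule ℝ (V → V → ℝ) where
  carrier := {b | IsBilinearMap ℝ b}
  zero_mem' := ⟨by simp, by simp, by simp, by simp⟩
  add_mem' := fun {b b'} hb hb' =>
    ⟨fun u v w => by simp only [Pi.add_apply, hb.add_left, hb'.add_left]; ring,
      fun r u v => by simp only [Pi.add_apply, hb.smul_left, hb'.smul_left, smul_add],
      fun u v w => by simp only [Pi.add_apply, hb.add_right, hb'.add_right]; ring,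
      fun r u v => by simp only [Pi.add_apply, hb.smul_right, hb'.smul_right, smul_add]⟩
  smul_mem' := fun r b hb =>
    ⟨fun u v w => by simp only [Pi.smul_apply, hb.add_left, smul_add],
      fun q u v => by simp only [Pi.smul_apply, hb.smul_left, smul_comm r q],
      fun u v w => by simp only [Pi.smul_apply, hb.add_right, smul_add],
      fun q u v => by simp only [Pi.smul_apply, hb.smul_right, smul_comm r q]⟩

variable (V W) in
/-- The maps `l : V → X → W` that are linear in `V` at every point of `s` and continuous on `s`. -/
def linearFamilies (s : Set X) : Submodule ℝ (V → X → W) where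
  carrier := {l | (∀ x ∈ s, IsLinearMap ℝ fun v => l v x) ∧ ∀ v, ContinuousOn (l v) s}
  zero_mem' := ⟨fun _ _ => ⟨by simp, by simp⟩, fun _ => continuousOn_const⟩
  add_mem' := fun hl hm =>
    ⟨fun x hx => ((hl.1 x hx).mk' _ + (hm.1 x hx).mk' _).isLinear,
      fun v => (hl.2 v).add (hm.2 v)⟩
  smul_mem' := fun r _ hl =>
    ⟨fun x hx => (r • (hl.1 x hx).mk' _).isLinear, fun v => (hl.2 v).const_smul r⟩

variable (V) in
/-- The maps `b : V → V → X → ℝ` that are bilinear at every point of `s` and continuous on `s`. -/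
def bilinearFamilies (s : Set X) : Submodule ℝ (V → V → X → ℝ) where
  carrier := {b | (∀ x ∈ s, (fun u v => b u v x) ∈ bilinearForms V) ∧ ∀ u v, ContinuousOn (b u v) s}
  zero_mem' := ⟨fun _ _ => zero_mem (bilinearForms V), fun _ _ => continuousOn_const⟩
  add_mem' := fun hb hb' =>
    ⟨fun x hx => add_mem (hb.1 x hx) (hb'.1 x hx), fun u v => (hb.2 u v).add (hb'.2 u v)⟩
  smul_mem' := fun r _ hb =>
    ⟨fun x hx => (bilinearForms V).smul_mem r (hb.1 x hx), fun u v => (hb.2 u v).const_smul r⟩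

variable {l : V → X → W} {m : V → X → W'}

theorem linearFamilies_mono (h : s ⊆ t) : linearFamilies V W t ≤ linearFamilies V W s :=
  fun _ hl => ⟨fun x hx => hl.1 x (h hx), fun v => (hl.2 v).mono h⟩

theorem linearFamilies_smul {w : X → ℝ} (hw : ContinuousOn w s) (hl : l ∈ linearFamilies V W s) :
    (fun v x => w x • l v x) ∈ linearFamilies V W s :=
  ⟨fun x hx => (w x • (hl.1 x hx).mk' _).isLinear, fun v => hw.smul (hl.2 v)⟩

theorem linearFamilies_clm_comp (A : W →L[ℝ] W') (hl : l ∈ linearFamilies V W s) :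
    (fun v x => A (l v x)) ∈ linearFamilies V W' s :=
  ⟨fun x hx => ((A : W →ₗ[ℝ] W') ∘ₗ (hl.1 x hx).mk' _).isLinear,
    fun v => A.continuous.comp_continuousOn (hl.2 v)⟩

theorem clm_mem_bilinearFamilies (B : W →L[ℝ] W' →L[ℝ] ℝ) (hl : l ∈ linearFamilies V W s)
    (hm : m ∈ linearFamilies V W' s) : (fun u v x => B (l u x) (m v x)) ∈ bilinearFamilies V s := by
  refine ⟨fun x hx => ⟨fun u v w => ?_, fun r u v => ?_, fun u v w => ?_, fun r u v => ?_⟩,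
    fun u v => (B.continuous.comp_continuousOn (hl.2 u)).clm_apply (hm.2 v)⟩
  · simp [(hl.1 x hx).map_add]
  · simp [(hl.1 x hx).map_smul]
  · simp [(hm.1 x hx).map_add]
  · simp [(hm.1 x hx).map_smul]

theorem mul_mem_bilinearFamilies {l m : V → X → ℝ} (hl : l ∈ linearFamilies V ℝ s)
    (hm : m ∈ linearFamilies V ℝ s) : (fun u v x => l u x * m v x) ∈ bilinearFamilies V s :=
  clm_mem_bilinearFamilies (ContinuousLinearMap.mul ℝ ℝ) hl hm

theorem inner_mem_bilinearFamilies {H : Type*} [NormedAddCommGroup H] [InnerProductSpace ℝ H]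
    {l m : V → X → H} (hl : l ∈ linearFamilies V H s) (hm : m ∈ linearFamilies V H s) :
    (fun u v x => ⟪l u x, m v x⟫_ℝ) ∈ bilinearFamilies V s :=
  clm_mem_bilinearFamilies (innerSL ℝ) hl hm

theorem flip_mem_bilinearForms {b : V → V → ℝ} (hb : b ∈ bilinearForms V) :
    (fun u v => b v u) ∈ bilinearForms V :=
  ⟨fun u v w => hb.add_right w u v, fun r u v => hb.smul_right r v u,
    fun u v w => hb.add_left v w u, fun r u v => hb.smul_left r v u⟩

theorem setIntegral_mem_bilinearForms [T2Space X] [MeasurableSpace X] [BorelSpace X] {ν : Measure X}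
    (hs : IsCompact s) (hν : ν s ≠ ⊤) {b : V → V → X → ℝ} (hb : b ∈ bilinearFamilies V s) :
    (fun u v => ∫ x in s, b u v x ∂ν) ∈ bilinearForms V := by
  have hint (u v) : IntegrableOn (b u v) s ν :=
    (hb.2 u v).integrableOn_of_subset_isCompact hs hs.measurableSet subset_rfl hν
  have hcongr {g g' : X → ℝ} (h : EqOn g g' s) : ∫ x in s, g x ∂ν = ∫ x in s, g' x ∂ν :=
    setIntegral_congr_fun hs.measurableSet h
  refine ⟨fun u v w => ?_, fun r u v => ?_, fun u v w => ?_, fun r u v => ?_⟩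
  · rw [← integral_add (hint u w) (hint v w)]
    exact hcongr fun x hx => (hb.1 x hx).add_left u v w
  · rw [← integral_smul]
    exact hcongr fun x hx => (hb.1 x hx).smul_left r u v
  · rw [← integral_add (hint u v) (hint u w)]
    exact hcongr fun x hx => (hb.1 x hx).add_right u v w
  · rw [← integral_smul]
    exact hcongr fun x hx => (hb.1 x hx).smul_right r u v

end BilinearFamilies

theorem fderivWithin_mem_linearFamilies {V X W : Type*} [AddCommGroup V] [Module ℝ V]
    [NormedAddCommGroup X] [NormedSpace ℝ X] [NormedAddCommGroup W] [NormedSpace ℝ W] {s : Set X}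
    (hs : UniqueDiffOn ℝ s) (A : V →ₗ[ℝ] X → W) (hA : ∀ v, ContDiffOn ℝ 1 (A v) s) :
    (fun v x => fderivWithin ℝ (A v) s x) ∈ linearFamilies V (X →L[ℝ] W) s := by
  have hdiff (v) : DifferentiableOn ℝ (A v) s := (hA v).differentiableOn one_ne_zero
  refine ⟨fun x hx => ⟨fun u v => ?_, fun r u => ?_⟩,
    fun v => (hA v).continuousOn_fderivWithin hs le_rfl⟩
  · simp only [map_add, fderivWithin_add (hs x hx) (hdiff u x hx) (hdiff v x hx)]
  · simp only [map_smul, fderivWithin_const_smul (hs x hx) (hdiff u x hx)]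

theorem continuous_pos : Continuous pos := by unfold pos; fun_prop

theorem continuous_neg : Continuous neg := by unfold neg; fun_prop

namespace Triangulation

variable {T : Triangulation d} {K F : Finset (E d)} {μ θ : ℝ} {β : E d → E d} {c : E d → ℝ}
  {γ₁ γ₂ : Finset (E d) → ℝ}

theorem eval_mem_linearFamilies (hK : K ∈ T.elements) :
    (fun (v : T.piecewiseC2) x => v.1 x) ∈ linearFamilies T.piecewiseC2 ℝ (simplex K) :=
  ⟨fun _ _ => ⟨fun _ _ => rfl, fun _ _ => rfl⟩, fun v => (v.2 K hK).continuousOn⟩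

theorem gradOn_mem_linearFamilies (hK : K ∈ T.elements) :
    (fun (v : T.piecewiseC2) x => gradOn K v x) ∈
      linearFamilies T.piecewiseC2 (E d) (simplex K) := by
  have h := fderivWithin_mem_linearFamilies (uniqueDiffOn_simplex hK) T.piecewiseC2.subtype
    fun v => (v.2 K hK).of_le one_le_two
  refine ⟨fun x hx => ⟨fun u v => ?_, fun r v => ?_⟩,
    fun v => (InnerProductSpace.toDual ℝ (E d)).symm.continuous.comp_continuousOn (h.2 v)⟩
  · exact (congrArg _ ((h.1 x hx).map_add u v)).trans (map_add _ _ _)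
  · exact (congrArg _ ((h.1 x hx).map_smul r v)).trans
      ((InnerProductSpace.toDual ℝ (E d)).symm.map_smulₛₗ r _)

theorem lapOn_mem_linearFamilies (hK : K ∈ T.elements) :
    (fun (v : T.piecewiseC2) x => lapOn K v x) ∈ linearFamilies T.piecewiseC2 ℝ (simplex K) := by
  have hu := uniqueDiffOn_simplex hK
  refine ⟨fun x hx => ⟨fun u v => ?_, fun r v => ?_⟩, fun v => ?_⟩
  · exact (u.2 K hK x hx).laplacianWithin_add (v.2 K hK x hx) hu hx
  · exact InnerProductSpace.laplacianWithin_smul r (v.2 K hK x hx) hu hx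
  · have hD := (v.2 K hK).continuousOn_iteratedFDerivWithin (m := 2) le_rfl hu
    refine ContinuousOn.congr (continuousOn_finsetSum _ fun i _ => ?_) fun x hx =>
      InnerProductSpace.laplacianWithin_eq_iteratedFDerivWithin_stdOrthonormalBasis v.1 hu hx
    let e := stdOrthonormalBasis ℝ (E d) i
    let eval := ContinuousMultilinearMap.apply ℝ (fun _ : Fin 2 => E d) ℝ ![e, e]
    exact eval.continuous.comp_continuousOn hD

theorem divOn_smul_mem_linearFamilies (hK : K ∈ T.elements) (hβ : ContDiffOn ℝ 1 β (simplex K)) :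
    (fun (v : T.piecewiseC2) x => divOn K (fun y => v.1 y • β y) x) ∈
      linearFamilies T.piecewiseC2 ℝ (simplex K) := by
  let A : T.piecewiseC2 →ₗ[ℝ] E d → E d :=
    { toFun := fun v y => v.1 y • β y
      map_add' := fun _ _ => funext fun _ => add_smul _ _ _
      map_smul' := fun _ _ => funext fun _ => mul_smul _ _ _ }
  have h := fderivWithin_mem_linearFamilies (uniqueDiffOn_simplex hK) A
    fun v => ((v.2 K hK).of_le one_le_two).smul hβ
  have hsum := sum_mem (t := Finset.univ) fun (i : Fin d) _ => linearFamilies_clm_comp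
    (EuclideanSpace.proj i ∘L ContinuousLinearMap.apply ℝ (E d) (EuclideanSpace.single i 1)) h
  convert hsum using 1
  ext v x
  simp [divOn, A, Finset.sum_apply]

theorem a_mem_bilinearForms (hβ : ∀ K ∈ T.elements, ContDiffOn ℝ 1 β (simplex K))
    (hc : ∀ K ∈ T.elements, ContinuousOn c (simplex K)) :
    (fun u v : T.piecewiseC2 => T.a μ β c u v) ∈ bilinearForms T.piecewiseC2 := by
  have hdiff := sum_mem fun K hK => setIntegral_mem_bilinearForms (ν := volume)
    (isCompact_simplex K) (isCompact_simplex K).measure_ne_top <|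
      (bilinearFamilies T.piecewiseC2 (simplex K)).smul_mem μ <|
        inner_mem_bilinearFamilies (gradOn_mem_linearFamilies hK) (gradOn_mem_linearFamilies hK)
  have hconv := sum_mem fun K hK => setIntegral_mem_bilinearForms (ν := volume)
    (isCompact_simplex K) (isCompact_simplex K).measure_ne_top <|
      mul_mem_bilinearFamilies (add_mem (divOn_smul_mem_linearFamilies hK (hβ K hK))
        (linearFamilies_smul (hc K hK) (eval_mem_linearFamilies hK))) (eval_mem_linearFamilies hK)
  convert add_mem hdiff hconv using 1
  ext u v
  simp [a, Finset.sum_apply]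

theorem finrank_vectorSpan_face (hF : F ∈ T.complex.faces) (hcard : F.card = d) :
    finrank ℝ (vectorSpan ℝ (simplex F)) = d - 1 := by
  rw [finrank_vectorSpan_simplex (T.complex.indep hF) (T.complex.nonempty_of_mem_faces hF), hcard]

theorem euclideanHausdorffMeasure_face_lt_top (hF : F ∈ T.complex.faces) (hcard : F.card = d) :
    (μHE[d - 1] : Measure (E d)) (simplex F) < ⊤ :=
  euclideanHausdorffMeasure_lt_top (isCompact_simplex F) (finrank_vectorSpan_face hF hcard)

theorem faceIntegral_mem_bilinearForms {V : Type*} [AddCommGroup V] [Module ℝ V]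
    (hF : F ∈ T.complex.faces) (hcard : F.card = d) {b : V → V → E d → ℝ}
    (hb : b ∈ bilinearFamilies V (simplex F)) :
    (fun u v => faceIntegral F (b u v)) ∈ bilinearForms V :=
  setIntegral_mem_bilinearForms (isCompact_simplex F)
    (euclideanHausdorffMeasure_face_lt_top hF hcard).ne hb

theorem boundaryIntegral_mem_bilinearForms
    {l m : Finset (E d) → Finset (E d) → T.piecewiseC2 → E d → ℝ}
    (hl : ∀ F ∈ T.boundaryFaces, ∀ K ∈ T.elementsAt F,
      l K F ∈ linearFamilies T.piecewiseC2 ℝ (simplex K))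
    (hm : ∀ F ∈ T.boundaryFaces, ∀ K ∈ T.elementsAt F,
      m K F ∈ linearFamilies T.piecewiseC2 ℝ (simplex K)) :
    (fun u v => T.boundaryIntegral fun K F x => l K F u x * m K F v x) ∈
      bilinearForms T.piecewiseC2 := by
  have hsum := sum_mem fun F hF => sum_mem fun K hK =>
    faceIntegral_mem_bilinearForms (mem_boundaryFaces.1 hF).1 (mem_boundaryFaces.1 hF).2.1 <|
      mul_mem_bilinearFamilies
        (linearFamilies_mono (simplex_subset_of_mem_elementsAt hK) (hl F hF K hK))
        (linearFamilies_mono (simplex_subset_of_mem_elementsAt hK) (hm F hF K hK))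
  convert hsum using 1
  ext u v
  simp [boundaryIntegral, Finset.sum_apply]

theorem boundaryIntegral_weight_mem_bilinearForms {w : Finset (E d) → Finset (E d) → E d → ℝ}
    (hw : ∀ F ∈ T.boundaryFaces, ∀ K ∈ T.elementsAt F, ContinuousOn (w K F) (simplex K)) :
    (fun u v : T.piecewiseC2 => T.boundaryIntegral fun K F x => w K F x * u.1 x * v.1 x) ∈
      bilinearForms T.piecewiseC2 :=
  boundaryIntegral_mem_bilinearForms
    (l := fun K F u x => w K F x • u.1 x) (m := fun _ _ v x => v.1 x)
    (fun F hF K hK => linearFamilies_smul (hw F hF K hK)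
      (eval_mem_linearFamilies (mem_elementsAt.1 hK).1))
    (fun _ _ _ hK => eval_mem_linearFamilies (mem_elementsAt.1 hK).1)

theorem ah_mem_bilinearForms (hβ : ∀ K ∈ T.elements, ContDiffOn ℝ 1 β (simplex K))
    (hc : ∀ K ∈ T.elements, ContinuousOn c (simplex K)) :
    (fun u v : T.piecewiseC2 => T.ah μ β c θ u v) ∈ bilinearForms T.piecewiseC2 := by
  have hflux : (fun u v : T.piecewiseC2 => T.boundaryIntegral fun K F x =>
      ⟪gradOn K u x, normal K F⟫_ℝ * v.1 x) ∈ bilinearForms T.piecewiseC2 := by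
    refine boundaryIntegral_mem_bilinearForms
      (l := fun K F u x => ⟪gradOn K u x, normal K F⟫_ℝ) (m := fun _ _ v x => v.1 x)
      (fun F _ K hK => ?_) fun _ _ _ hK => eval_mem_linearFamilies (mem_elementsAt.1 hK).1
    exact linearFamilies_clm_comp ((innerSL ℝ).flip (normal K F))
      (gradOn_mem_linearFamilies (mem_elementsAt.1 hK).1)
  have hinflow := boundaryIntegral_weight_mem_bilinearForms (T := T)
    (w := fun K F x => neg ⟪β x, normal K F⟫_ℝ) fun F _ K hK =>
      continuous_neg.comp_continuousOn
        ((hβ K (mem_elementsAt.1 hK).1).continuousOn.inner continuousOn_const)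
  exact sub_mem (sub_mem (sub_mem (a_mem_bilinearForms hβ hc)
    ((bilinearForms _).smul_mem θ hflux))
    ((bilinearForms _).smul_mem θ (flip_mem_bilinearForms hflux))) hinflow

theorem gradJumpProd_mem_bilinearFamilies (T : Triangulation d) (F : Finset (E d)) :
    (fun u v : T.piecewiseC2 => T.gradJumpProd F u v) ∈
      bilinearFamilies T.piecewiseC2 (simplex F) := by
  have htrace (K) (hK : K ∈ T.elementsAt F) := linearFamilies_mono
    (simplex_subset_of_mem_elementsAt hK) (gradOn_mem_linearFamilies (mem_elementsAt.1 hK).1)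
  have hsum := (bilinearFamilies T.piecewiseC2 (simplex F)).smul_mem (1 / 2) <|
    sum_mem fun K hK => sum_mem fun K' hK' =>
      inner_mem_bilinearFamilies (sub_mem (htrace K hK) (htrace K' hK'))
        (sub_mem (htrace K hK) (htrace K' hK'))
  convert hsum using 1
  ext u v x
  simp [gradJumpProd, Finset.sum_apply]

theorem lapJumpProd_mem_bilinearFamilies (T : Triangulation d) (F : Finset (E d)) :
    (fun u v : T.piecewiseC2 => T.lapJumpProd F u v) ∈
      bilinearFamilies T.piecewiseC2 (simplex F) := by
  have htrace (K) (hK : K ∈ T.elementsAt F) := linearFamilies_mono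
    (simplex_subset_of_mem_elementsAt hK) (lapOn_mem_linearFamilies (mem_elementsAt.1 hK).1)
  have hsum := (bilinearFamilies T.piecewiseC2 (simplex F)).smul_mem (1 / 2) <|
    sum_mem fun K hK => sum_mem fun K' hK' =>
      mul_mem_bilinearFamilies (sub_mem (htrace K hK) (htrace K' hK'))
        (sub_mem (htrace K hK) (htrace K' hK'))
  convert hsum using 1
  ext u v x
  simp [lapJumpProd, Finset.sum_apply]

theorem scip_mem_bilinearForms (T : Triangulation d) (γ₁ γ₂ : Finset (E d) → ℝ) :
    (fun u v : T.piecewiseC2 => T.scip γ₁ γ₂ u v) ∈ bilinearForms T.piecewiseC2 := by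
  have hsum := sum_mem fun F (hF : F ∈ T.interiorFaces) =>
    faceIntegral_mem_bilinearForms (mem_interiorFaces.1 hF).1 (mem_interiorFaces.1 hF).2.1 <|
      add_mem ((bilinearFamilies _ _).smul_mem (diam F * γ₁ F)
          (T.gradJumpProd_mem_bilinearFamilies F))
        ((bilinearFamilies _ _).smul_mem (diam F ^ 3 * γ₂ F) (T.lapJumpProd_mem_bilinearFamilies F))
  convert hsum using 1
  ext u v
  simp only [scip, Finset.sum_apply]
  rfl

theorem sbc_mem_bilinearForms {σ : ℝ → ℝ} (hσ : Continuous σ)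
    (hβ : ∀ K ∈ T.elements, ContinuousOn β (simplex K)) :
    (fun u v : T.piecewiseC2 => T.sbc σ μ β u v) ∈ bilinearForms T.piecewiseC2 :=
  add_mem
    (boundaryIntegral_weight_mem_bilinearForms (w := fun _ _ _ => μ * T.meshSize⁻¹)
      fun _ _ _ _ => continuousOn_const)
    (boundaryIntegral_weight_mem_bilinearForms (w := fun K F x => |σ ⟪β x, normal K F⟫_ℝ|)
      fun _ _ K hK => (hσ.comp_continuousOn
        ((hβ K (mem_elementsAt.1 hK).1).inner continuousOn_const)).abs)

theorem sp_mem_bilinearForms (hβ : ∀ K ∈ T.elements, ContinuousOn β (simplex K)) :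
    (fun u v : T.piecewiseC2 => T.sp μ β γ₁ γ₂ u v) ∈ bilinearForms T.piecewiseC2 :=
  add_mem (T.scip_mem_bilinearForms γ₁ γ₂) (sbc_mem_bilinearForms continuous_neg hβ)

theorem sa_mem_bilinearForms (hβ : ∀ K ∈ T.elements, ContinuousOn β (simplex K)) :
    (fun u v : T.piecewiseC2 => T.sa μ β γ₁ γ₂ u v) ∈ bilinearForms T.piecewiseC2 :=
  add_mem (T.scip_mem_bilinearForms γ₁ γ₂) (sbc_mem_bilinearForms continuous_pos hβ)

end Triangulation

theorem exists_isGreatest_ray {V : Type*} [NormedAddCommGroup V] [NormedSpace ℝ V] {s : Set V}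
    (hs : IsCompact s) {x w : V} (hx : x ∈ s) (hw : w ≠ 0) :
    ∃ t, IsGreatest {t : ℝ | 0 ≤ t ∧ x + t • w ∈ s} t := by
  have hray : IsClosedEmbedding fun t : ℝ => x + t • w :=
    (Homeomorph.addLeft x).isClosedEmbedding.comp (isClosedEmbedding_smul_left hw)
  have hcompact : IsCompact {t : ℝ | 0 ≤ t ∧ x + t • w ∈ s} :=
    (hray.isCompact_preimage hs).inter_left isClosed_Ici
  exact hcompact.exists_isGreatest ⟨0, le_rfl, by simpa using hx⟩

theorem affineMap_eq_sum_coord_mul {ι V : Type*} [Fintype ι] [AddCommGroup V] [Module ℝ V]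
    (b : AffineBasis ι ℝ V) (f : V →ᵃ[ℝ] ℝ) (x : V) : f x = ∑ i, b.coord i x * f (b i) := by
  conv_lhs => rw [← b.affineCombination_coord_eq_self x]
  rw [Finset.map_affineCombination _ _ _ (b.sum_coord_apply_eq_one x),
    Finset.affineCombination_eq_linear_combination _ _ _ (b.sum_coord_apply_eq_one x)]
  rfl

namespace Triangulation

variable {T : Triangulation d} {K K' F s : Finset (E d)} {x y : E d}

theorem mem_simplex_of_coord_eq_zero (hK : K ∈ T.elements) (hy : y ∈ simplex K)
    (hzero : ∀ v : K, v.1 ∉ s → (vertexBasis hK).coord v y = 0) : y ∈ simplex s := by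
  classical
  have hrestrict {M : Type} [AddCommMonoid M] (φ : K → M) (hφ : ∀ v : K, v.1 ∉ s → φ v = 0) :
      ∑ v with v.1 ∈ s, φ v = ∑ v, φ v :=
    Finset.sum_filter_of_ne fun v _ => not_imp_comm.1 (hφ v)
  rw [← (vertexBasis hK).linear_combination_coord_eq_self y,
    ← hrestrict _ fun v hv => by rw [hzero v hv, zero_smul]]
  refine (convex_simplex s).sum_mem (fun v _ => (mem_simplex_iff_coord_nonneg hK).1 hy v) ?_
    fun v hv => subset_simplex s (Finset.mem_filter.1 hv).2
  rw [hrestrict _ hzero, (vertexBasis hK).sum_coord_apply_eq_one]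

theorem coord_eq_zero_of_mem_simplex (hK : K ∈ T.elements) (hs : s ∈ T.complex.faces) {v : K}
    (hv : v.1 ∉ s) (hyK : y ∈ simplex K) (hys : y ∈ simplex s) :
    (vertexBasis hK).coord v y = 0 := by
  have hzero : convexHull ℝ (K ∩ s : Set (E d)) ⊆ (vertexBasis hK).coord v ⁻¹' {0} := by
    refine convexHull_min (fun w hw => ?_) ((convex_singleton 0).affine_preimage _)
    exact (vertexBasis hK).coord_apply_ne (j := ⟨w, hw.1⟩) fun h =>
      hv (congrArg Subtype.val h ▸ hw.2)
  exact hzero (T.complex.inter_subset_convexHull (mem_elements.1 hK).1 hs ⟨hyK, hys⟩)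

/-- The union of the simplices of dimension at most `d - 2`. -/
def codimTwoSkeleton (T : Triangulation d) : Set (E d) :=
  ⋃ s ∈ {s ∈ T.complex.faces | s.card < d}, simplex s

theorem coord_pos_of_notMem_codimTwoSkeleton (hK : K ∈ T.elements) (hyK : y ∈ simplex K)
    (hy : y ∉ T.codimTwoSkeleton) {a v : K} (ha : (vertexBasis hK).coord a y = 0) (hva : v ≠ a) :
    0 < (vertexBasis hK).coord v y := by
  classical
  refine ((mem_simplex_iff_coord_nonneg hK).1 hyK v).lt_of_ne fun hv => hy ?_
  let s := (K.erase a).erase v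
  have hsK : s ⊆ K := (Finset.erase_subset _ _).trans (Finset.erase_subset _ _)
  have hys : y ∈ simplex s := by
    refine mem_simplex_of_coord_eq_zero hK hyK fun i hi => ?_
    obtain rfl | rfl : i = v ∨ i = a := by
      by_contra! h
      exact hi (Finset.mem_erase.2 ⟨Subtype.coe_ne_coe.2 h.1,
        Finset.mem_erase.2 ⟨Subtype.coe_ne_coe.2 h.2, i.2⟩⟩)
    · exact hv.symm
    · exact ha
  have hscard : s.card < d := by
    have hcard := (mem_elements.1 hK).2
    have ha := Finset.card_erase_of_mem a.2
    have hv := Finset.card_erase_of_mem (Finset.mem_erase.2 ⟨Subtype.coe_ne_coe.2 hva, v.2⟩)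
    have := Finset.card_pos.2 ⟨v.1, Finset.mem_erase.2 ⟨Subtype.coe_ne_coe.2 hva, v.2⟩⟩
    lia
  have hs : s ∈ T.complex.faces := T.complex.down_closed (mem_elements.1 hK).1 hsK
    (Finset.coe_nonempty.1 (convexHull_nonempty_iff.1 ⟨y, hys⟩))
  exact mem_biUnion ⟨hs, hscard⟩ hys

/-- The vertex `a` of `K` is the one opposite to the facet `F` of `K`. -/
def IsOppositeVertex (F : Finset (E d)) (a : K) : Prop :=
  ∀ v : K, v.1 ∈ F ↔ v ≠ a

theorem exists_isOppositeVertex (hK : K ∈ T.elementsAt F) (hF : F.card = d) :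
    ∃ a : K, IsOppositeVertex F a := by
  classical
  obtain ⟨hKT, hFK⟩ := mem_elementsAt.1 hK
  obtain ⟨a, haF, rfl⟩ := Finset.exists_eq_insert_iff.2 ⟨hFK, by rw [hF, (mem_elements.1 hKT).2]⟩
  exact ⟨⟨a, Finset.mem_insert_self _ _⟩, fun v => ⟨fun hv h => haF (by rwa [h] at hv), fun hv =>
    (Finset.mem_insert.1 v.2).resolve_left fun h => hv (Subtype.ext h)⟩⟩

theorem IsOppositeVertex.notMem {a : K} (ha : IsOppositeVertex F a) : a.1 ∉ F :=
  fun h => (ha a).1 h rfl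

theorem IsOppositeVertex.notMem_of_ne {a' : K'} (ha' : IsOppositeVertex F a')
    (hK : K ∈ T.elementsAt F) (hK' : K' ∈ T.elementsAt F) (hne : K' ≠ K) : a'.1 ∉ K := by
  intro haK
  obtain ⟨hKT, hFK⟩ := mem_elementsAt.1 hK
  have hsub : K' ⊆ K := fun v hv => by
    by_cases h : v = a'
    · exact h ▸ haK
    · exact hFK ((ha' ⟨v, hv⟩).2 fun h' => h (congrArg Subtype.val h'))
  refine hne (Finset.eq_of_subset_of_card_le hsub ?_)
  rw [(mem_elements.1 hKT).2, (mem_elements.1 (mem_elementsAt.1 hK').1).2]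

theorem exists_mem_simplex_coord_pos (hK : K ∈ T.elements) (hFK : F ⊆ K) (hF : F.Nonempty) :
    ∃ y ∈ simplex F, ∀ v : K, v.1 ∈ F → 0 < (vertexBasis hK).coord v y := by
  classical
  obtain ⟨v₀, hv₀⟩ := hF
  let t : Finset K := F.subtype (· ∈ K)
  have ht {v : K} : v ∈ t ↔ v.1 ∈ F := Finset.mem_subtype
  have htne : t.Nonempty := ⟨⟨v₀, hFK hv₀⟩, ht.2 hv₀⟩
  have hsum : ∑ v ∈ t, t.centroidWeights ℝ v = 1 := t.sum_centroidWeights_eq_one_of_nonempty ℝ htne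
  let y : E d := t.centroid ℝ (vertexBasis hK)
  have hpos (v : K) (hv : v.1 ∈ F) : 0 < (vertexBasis hK).coord v y :=
    ((inv_pos.2 (Nat.cast_pos.2 htne.card_pos)).trans_eq
      ((vertexBasis hK).coord_apply_combination_of_mem (ht.2 hv) hsum).symm)
  have hzero (v : K) (hv : v.1 ∉ F) : (vertexBasis hK).coord v y = 0 :=
    (vertexBasis hK).coord_apply_combination_of_notMem (mt ht.1 hv) hsum
  refine ⟨y, mem_simplex_of_coord_eq_zero hK ((mem_simplex_iff_coord_nonneg hK).2 fun v => ?_)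
    hzero, hpos⟩
  by_cases hv : v.1 ∈ F
  · exact (hpos v hv).le
  · exact (hzero v hv).ge

theorem eventually_lineMap_mem_simplex (hK : K ∈ T.elements) (hy : y ∈ simplex K)
    (h : ∀ v, 0 < (vertexBasis hK).coord v y ∨ 0 ≤ (vertexBasis hK).coord v x) :
    ∀ᶠ t : ℝ in 𝓝[>] 0, AffineMap.lineMap y x t ∈ simplex K := by
  simp only [mem_simplex_iff_coord_nonneg hK, AffineMap.apply_lineMap]
  refine eventually_all.2 fun v => ?_
  obtain hv | hv := h v
  · have hcont : Continuous fun t : ℝ =>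
        AffineMap.lineMap ((vertexBasis hK).coord v y) ((vertexBasis hK).coord v x) t :=
      AffineMap.lineMap_continuous
    have hpos := hcont.continuousAt.eventually
      (lt_mem_nhds (by simpa using hv : 0 < AffineMap.lineMap ((vertexBasis hK).coord v y)
        ((vertexBasis hK).coord v x) (0 : ℝ)))
    exact (hpos.filter_mono nhdsWithin_le_nhds).mono fun _ h => h.le
  · filter_upwards [Ioo_mem_nhdsGT zero_lt_one] with t ht
    exact (convex_Ici (0 : ℝ)).lineMap_mem ((mem_simplex_iff_coord_nonneg hK).1 hy v)
      (mem_Ici.2 hv) ⟨ht.1.le, ht.2.le⟩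

theorem coord_neg_of_isOppositeVertex (hK : K ∈ T.elementsAt F) (hK' : K' ∈ T.elementsAt F)
    (hF : F ∈ T.complex.faces) (hne : K ≠ K') {a : K} {a' : K'} (ha : IsOppositeVertex F a)
    (ha' : IsOppositeVertex F a') :
    (vertexBasis (mem_elementsAt.1 hK).1).coord a a' < 0 := by
  obtain ⟨hKT, hFK⟩ := mem_elementsAt.1 hK
  obtain ⟨hKT', hFK'⟩ := mem_elementsAt.1 hK'
  obtain ⟨y, hyF, hy⟩ := exists_mem_simplex_coord_pos hKT hFK (T.complex.nonempty_of_mem_faces hF)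
  have hyK' : y ∈ simplex K' := simplex_mono hFK' hyF
  by_contra! hcoord
  -- Otherwise the segment from `y ∈ F` to `a'` starts inside `K ∩ K'`, yet leaves `F` at once.
  have hstart : ∀ᶠ t : ℝ in 𝓝[>] 0, AffineMap.lineMap y a'.1 t ∈ simplex K := by
    refine eventually_lineMap_mem_simplex hKT (simplex_mono hFK hyF) fun v => ?_
    obtain rfl | hv := eq_or_ne v a
    · exact .inr hcoord
    · exact .inl (hy v ((ha v).2 hv))
  obtain ⟨t, htK, ht⟩ := (hstart.and (Ioo_mem_nhdsGT zero_lt_one)).exists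
  have htK' := (convex_simplex K').lineMap_mem hyK' (subset_simplex K' a'.2) ⟨ht.1.le, ht.2.le⟩
  have hzero := coord_eq_zero_of_mem_simplex hKT' (mem_elements.1 hKT).1
    (ha'.notMem_of_ne hK hK' hne.symm) htK' htK
  have hone : (vertexBasis hKT').coord a' a' = 1 := (vertexBasis hKT').coord_apply_eq a'
  rw [AffineMap.apply_lineMap, coord_eq_zero_of_mem_simplex hKT' hF ha'.notMem hyK' hyF, hone,
    AffineMap.lineMap_apply_ring'] at hzero
  linarith [ht.1]

theorem coord_eq_mul_coord (hK : K ∈ T.elements) (hK' : K' ∈ T.elements) (hFK : F ⊆ K)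
    {a : K} {a' : K'} (ha : IsOppositeVertex F a) (ha' : IsOppositeVertex F a') (x : E d) :
    (vertexBasis hK).coord a x = (vertexBasis hK').coord a' x * (vertexBasis hK).coord a a' := by
  have hzero (v : K') (hv : v ≠ a') : (vertexBasis hK).coord a (vertexBasis hK' v) = 0 := by
    have hvF := (ha' v).2 hv
    have hva := (ha ⟨v, hFK hvF⟩).1 hvF
    exact (vertexBasis hK).coord_apply_ne (j := ⟨v, hFK hvF⟩) hva.symm
  rw [affineMap_eq_sum_coord_mul (vertexBasis hK') ((vertexBasis hK).coord a) x]
  exact Finset.sum_eq_single_of_mem a' (Finset.mem_univ _) fun v _ hv =>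
    mul_eq_zero_of_right _ (hzero v hv)

theorem card_elementsAt_le_two (hF : F ∈ T.complex.faces) (hcard : F.card = d) :
    (T.elementsAt F).card ≤ 2 := by
  by_contra! h
  obtain ⟨K, hK, K', hK', K'', hK'', hne, hne', hne''⟩ := Finset.two_lt_card.1 h
  obtain ⟨a, ha⟩ := exists_isOppositeVertex hK hcard
  obtain ⟨a', ha'⟩ := exists_isOppositeVertex hK' hcard
  obtain ⟨a'', ha''⟩ := exists_isOppositeVertex hK'' hcard
  have hKT := mem_elementsAt.1 hK
  have h₁ := coord_neg_of_isOppositeVertex hK hK' hF hne ha ha'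
  have h₂ := coord_neg_of_isOppositeVertex hK hK'' hF hne' ha ha''
  have h₃ := coord_neg_of_isOppositeVertex hK' hK'' hF hne'' ha' ha''
  have hmul := coord_eq_mul_coord hKT.1 (mem_elementsAt.1 hK').1 hKT.2 ha ha' a''
  linarith [mul_pos_of_neg_of_neg h₁ h₃]

theorem simplex_union_simplex_mem_nhds (hF : F ∈ T.complex.faces) (hK : K ∈ T.elementsAt F)
    (hK' : K' ∈ T.elementsAt F) (hne : K ≠ K') {a : K} {a' : K'} (ha : IsOppositeVertex F a)
    (ha' : IsOppositeVertex F a')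
    (hy : ∀ v ≠ a, 0 < (vertexBasis (mem_elementsAt.1 hK).1).coord v y)
    (hy' : ∀ v ≠ a', 0 < (vertexBasis (mem_elementsAt.1 hK').1).coord v y) :
    simplex K ∪ simplex K' ∈ 𝓝 y := by
  obtain ⟨hKT, hFK⟩ := mem_elementsAt.1 hK
  have hKT' := (mem_elementsAt.1 hK').1
  have hpos {K : Finset (E d)} (hK : K ∈ T.elements) {a : K}
      (hy : ∀ v ≠ a, 0 < (vertexBasis hK).coord v y) :
      ∀ᶠ x in 𝓝 y, ∀ v, v ≠ a → 0 < (vertexBasis hK).coord v x :=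
    eventually_all.2 fun v => eventually_imp_distrib_left.2 fun hv =>
      ((vertexBasis hK).coord v).continuous_of_finiteDimensional.continuousAt.eventually
        (lt_mem_nhds (hy v hv))
  filter_upwards [hpos hKT hy, hpos hKT' hy'] with x hx hx'
  have hmem {K : Finset (E d)} (hK : K ∈ T.elements) {a : K}
      (hx : ∀ v, v ≠ a → 0 < (vertexBasis hK).coord v x) (ha : 0 ≤ (vertexBasis hK).coord a x) :
      x ∈ simplex K := by
    refine (mem_simplex_iff_coord_nonneg hK).2 fun v => ?_
    obtain rfl | hv := eq_or_ne v a
    · exact ha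
    · exact (hx v hv).le
  have hneg := coord_neg_of_isOppositeVertex hK hK' hF hne ha ha'
  have hmul := coord_eq_mul_coord hKT hKT' hFK ha ha' x
  obtain h | h := le_total 0 ((vertexBasis hKT).coord a x)
  · exact .inl (hmem hKT hx h)
  · exact .inr (hmem hKT' hx' (by nlinarith))

variable {g : E d} {b : ℝ} {u : E d → ℝ}

theorem exists_forall_notMem_codimTwoSkeleton (T : Triangulation d) (hd : 0 < d) (x : E d) :
    ∃ w : E d, w ≠ 0 ∧ ∀ t : ℝ, t ≠ 0 → x + t • w ∉ T.codimTwoSkeleton := by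
  classical
  let directions (s : Finset (E d)) : Submodule ℝ (E d) := Submodule.span ℝ (s.image (· - x))
  let S := T.finite.toFinset.filter fun s => s.card < d
  have hlt {p : Submodule ℝ (E d)} (hp : finrank ℝ p < d) : p ≠ ⊤ := by
    rintro rfl
    simp at hp
  have htop : ⊤ ∉ insert ⊥ (S.image directions) := by
    rw [Finset.mem_insert, Finset.mem_image, not_or, not_exists]
    refine ⟨(hlt (by simpa using hd)).symm, fun s ⟨hs, hst⟩ => hlt ?_ hst⟩
    exact ((finrank_span_finset_le_card _).trans Finset.card_image_le).trans_lt
      (Finset.mem_filter.1 hs).2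
  obtain ⟨w, hw⟩ := (ne_univ_iff_exists_notMem _).1 (Subspace.biUnion_ne_univ_of_top_notMem htop)
  have hw' : ∀ p ∈ insert ⊥ (S.image directions), w ∉ p := by simpa using hw
  refine ⟨w, fun h => hw' ⊥ (Finset.mem_insert_self _ _) (by simpa using h), fun t ht hmem => ?_⟩
  obtain ⟨s, ⟨hs, hcard⟩, hts⟩ := mem_iUnion₂.1 hmem
  have hspan : simplex s ⊆ {y | y - x ∈ directions s} := by
    refine convexHull_min (fun v hv => Submodule.subset_span ?_) ?_
    · exact Finset.mem_coe.2 (Finset.mem_image_of_mem _ hv)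
    · exact (directions s).convex.affine_preimage
        ((AffineMap.id ℝ (E d)) - AffineMap.const ℝ (E d) x)
  have htw : t • w ∈ directions s := by simpa using hspan hts
  exact hw' _ (Finset.mem_insert_of_mem (Finset.mem_image_of_mem _
    (Finset.mem_filter.2 ⟨T.finite.mem_toFinset.2 hs, hcard⟩)))
    (((directions s).smul_mem_iff ht).1 htw)

/-- The union of the elements on which `u` is the affine function `x ↦ ⟪g, x⟫ + b`. -/
def affineRegion (T : Triangulation d) (u : E d → ℝ) (g : E d) (b : ℝ) : Set (E d) :=
  ⋃ K ∈ {K : Finset (E d) | K ∈ T.elements ∧ EqOn u (fun x => ⟪g, x⟫_ℝ + b) (simplex K)}, simplex K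

theorem mem_affineRegion : y ∈ T.affineRegion u g b ↔
    ∃ K ∈ T.elements, EqOn u (fun x => ⟪g, x⟫_ℝ + b) (simplex K) ∧ y ∈ simplex K := by
  simp [affineRegion, and_assoc]

theorem simplex_subset_affineRegion (hK : K ∈ T.elements)
    (hu : EqOn u (fun x => ⟪g, x⟫_ℝ + b) (simplex K)) : simplex K ⊆ T.affineRegion u g b :=
  fun _ hx => mem_affineRegion.2 ⟨K, hK, hu, hx⟩

theorem isCompact_affineRegion (T : Triangulation d) (u : E d → ℝ) (g : E d) (b : ℝ) :
    IsCompact (T.affineRegion u g b) :=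
  (T.elements.finite_toSet.subset fun _ h => h.1).isCompact_biUnion fun K _ => isCompact_simplex K

theorem eqOn_inner_add_of_gradOn_eq (hK : K ∈ T.elements) (hK' : K' ∈ T.elements) (u : T.feSpace 1)
    (hu : EqOn u.1 (fun x => ⟪g, x⟫_ℝ + b) (simplex K)) (hy : y ∈ simplex K) (hy' : y ∈ simplex K')
    (hgrad : gradOn K u y = gradOn K' u y) : EqOn u.1 (fun x => ⟪g, x⟫_ℝ + b) (simplex K') := by
  obtain ⟨g', b', hu'⟩ := exists_eqOn_inner_add u hK'
  rw [gradOn_of_eqOn_inner_add (uniqueDiffOn_simplex hK) hu hy,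
    gradOn_of_eqOn_inner_add (uniqueDiffOn_simplex hK') hu' hy'] at hgrad
  subst hgrad
  obtain rfl : b = b' := add_left_cancel ((hu hy).symm.trans (hu' hy'))
  exact hu'

theorem exists_face_isOppositeVertex (hK : K ∈ T.elements) (hyK : y ∈ simplex K) {a : K}
    (ha : (vertexBasis hK).coord a y = 0) :
    ∃ F ∈ T.complex.faces, F.card = d ∧ F ⊆ K ∧ IsOppositeVertex F a ∧ y ∈ simplex F := by
  classical
  have hya : IsOppositeVertex (K.erase a) a := fun v => by
    rw [Finset.mem_erase, and_iff_left v.2, Subtype.coe_ne_coe]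
  have hyF : y ∈ simplex (K.erase a) := mem_simplex_of_coord_eq_zero hK hyK fun v hv => by
    obtain rfl : v = a := not_not.1 fun h => hv ((hya v).2 h)
    exact ha
  have hne : (K.erase a.1).Nonempty := Finset.coe_nonempty.1 (convexHull_nonempty_iff.1 ⟨y, hyF⟩)
  obtain ⟨hKT, hcard⟩ := mem_elements.1 hK
  refine ⟨K.erase a, T.complex.down_closed hKT (Finset.erase_subset _ _) hne, ?_,
    Finset.erase_subset _ _, hya, hyF⟩
  rw [Finset.card_erase_of_mem a.2, hcard, Nat.add_sub_cancel]

theorem affineRegion_mem_nhds (u : T.feSpace 1)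
    (hjump : ∀ F ∈ T.interiorFaces, ∀ K ∈ T.elementsAt F, ∀ K' ∈ T.elementsAt F,
      ∀ x ∈ simplex F, gradOn K u x = gradOn K' u x)
    (hy : y ∈ T.affineRegion u g b) (hskel : y ∉ T.codimTwoSkeleton)
    (hbd : ∀ F ∈ T.boundaryFaces, y ∉ simplex F) : T.affineRegion u g b ∈ 𝓝 y := by
  obtain ⟨K, hK, huK, hyK⟩ := mem_affineRegion.1 hy
  have hsubset := simplex_subset_affineRegion hK huK
  by_cases hpos : ∀ v, 0 < (vertexBasis hK).coord v y
  · exact mem_of_superset (mem_interior_iff_mem_nhds.1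
      ((mem_interior_simplex_iff_coord_pos hK).2 hpos)) hsubset
  push Not at hpos
  obtain ⟨a, ha⟩ := hpos
  replace ha := ha.antisymm ((mem_simplex_iff_coord_nonneg hK).1 hyK a)
  obtain ⟨F, hF, hcard, hFK, haF, hyF⟩ := exists_face_isOppositeVertex hK hyK ha
  have hKF : K ∈ T.elementsAt F := mem_elementsAt.2 ⟨hK, hFK⟩
  have hcardF : (T.elementsAt F).card = 2 := by
    have hle := card_elementsAt_le_two hF hcard
    have hpos : 0 < (T.elementsAt F).card := Finset.card_pos.2 ⟨K, hKF⟩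
    have hone : (T.elementsAt F).card ≠ 1 := fun h => hbd F (mem_boundaryFaces.2 ⟨hF, hcard, h⟩) hyF
    omega
  obtain ⟨K', hKF', hne⟩ := Finset.exists_mem_ne (hcardF ▸ one_lt_two) K
  obtain ⟨hK', hFK'⟩ := mem_elementsAt.1 hKF'
  obtain ⟨a', haF'⟩ := exists_isOppositeVertex hKF' hcard
  have hyK' := simplex_mono hFK' hyF
  have ha' := coord_eq_zero_of_mem_simplex hK' hF haF'.notMem hyK' hyF
  have huK' := eqOn_inner_add_of_gradOn_eq hK hK' u huK hyK hyK'
    (hjump F (mem_interiorFaces.2 ⟨hF, hcard, hcardF⟩) K hKF K' hKF' y hyF)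
  refine mem_of_superset (simplex_union_simplex_mem_nhds hF hKF hKF' hne.symm haF haF' ?_ ?_)
    (union_subset hsubset (simplex_subset_affineRegion hK' huK'))
  · exact fun v hv => coord_pos_of_notMem_codimTwoSkeleton hK hyK hskel ha hv
  · exact fun v hv => coord_pos_of_notMem_codimTwoSkeleton hK' hyK' hskel ha' hv

theorem exists_ray_mem_boundaryFace (u : T.feSpace 1)
    (hjump : ∀ F ∈ T.interiorFaces, ∀ K ∈ T.elementsAt F, ∀ K' ∈ T.elementsAt F,
      ∀ x ∈ simplex F, gradOn K u x = gradOn K' u x)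
    (hx : T.affineRegion u g b ∈ 𝓝 x) {w : E d} (hw : w ≠ 0)
    (hskel : ∀ t : ℝ, t ≠ 0 → x + t • w ∉ T.codimTwoSkeleton) :
    ∃ t : ℝ, 0 ≤ t ∧ x + t • w ∈ T.affineRegion u g b ∧
      ∃ F ∈ T.boundaryFaces, x + t • w ∈ simplex F := by
  obtain ⟨t, ⟨ht, hy⟩, hmax⟩ :=
    exists_isGreatest_ray (T.isCompact_affineRegion u g b) (mem_of_mem_nhds hx) hw
  have hexit : T.affineRegion u g b ∉ 𝓝 (x + t • w) := fun hnhds => by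
    have hcont : Tendsto (fun s : ℝ => x + s • w) (𝓝[>] t) (𝓝 (x + t • w)) :=
      (Continuous.tendsto (by fun_prop) t).mono_left nhdsWithin_le_nhds
    obtain ⟨s, hs, hts⟩ := ((hcont.eventually_mem hnhds).and self_mem_nhdsWithin).exists
    exact (hmax ⟨ht.trans hts.le, hs⟩).not_gt hts
  have ht0 : t ≠ 0 := by
    rintro rfl
    rw [zero_smul, add_zero] at hexit
    exact hexit hx
  refine ⟨t, ht, hy, ?_⟩
  by_contra! h
  exact hexit (affineRegion_mem_nhds u hjump hy (hskel t ht0) h)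

theorem eq_zero_of_mem_interior_simplex (hd : 0 < d) (u : T.feSpace 1)
    (hjump : ∀ F ∈ T.interiorFaces, ∀ K ∈ T.elementsAt F, ∀ K' ∈ T.elementsAt F,
      ∀ x ∈ simplex F, gradOn K u x = gradOn K' u x)
    (hbd : ∀ F ∈ T.boundaryFaces, EqOn u.1 0 (simplex F)) (hK : K ∈ T.elements)
    (hx : x ∈ interior (simplex K)) : u.1 x = 0 := by
  obtain ⟨g, b, hu⟩ := exists_eqOn_inner_add u hK
  obtain ⟨w, hw, hskel, hsign⟩ : ∃ w : E d, w ≠ 0 ∧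
      (∀ t : ℝ, t ≠ 0 → x + t • w ∉ T.codimTwoSkeleton) ∧ 0 ≤ u.1 x * ⟪g, w⟫_ℝ := by
    obtain ⟨w, hw, hskel⟩ := T.exists_forall_notMem_codimTwoSkeleton hd x
    obtain h | h := le_total 0 (u.1 x * ⟪g, w⟫_ℝ)
    · exact ⟨w, hw, hskel, h⟩
    · refine ⟨-w, neg_ne_zero.2 hw, fun t ht => ?_, by simpa using h⟩
      simpa using hskel (-t) (neg_ne_zero.2 ht)
  have hnhds : T.affineRegion u g b ∈ 𝓝 x := mem_of_superset (mem_interior_iff_mem_nhds.1 hx)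
    (simplex_subset_affineRegion hK hu)
  obtain ⟨t, ht, hy, F, hF, hyF⟩ := exists_ray_mem_boundaryFace u hjump hnhds hw hskel
  obtain ⟨K', -, hu', hyK'⟩ := mem_affineRegion.1 hy
  have hline : u.1 x + t * ⟪g, w⟫_ℝ = 0 := by
    rw [← show u.1 (x + t • w) = 0 from hbd F hF hyF, hu' hyK', hu (interior_subset hx)]
    simp only [inner_add_right, inner_smul_right]
    ring
  nlinarith [mul_nonneg ht hsign, sq_nonneg (u.1 x)]

theorem feSpace_eq_zero_of_gradOn_eq (hd : 0 < d) (u : T.feSpace 1)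
    (hjump : ∀ F ∈ T.interiorFaces, ∀ K ∈ T.elementsAt F, ∀ K' ∈ T.elementsAt F,
      ∀ x ∈ simplex F, gradOn K u x = gradOn K' u x)
    (hbd : ∀ F ∈ T.boundaryFaces, EqOn u.1 0 (simplex F)) : u = 0 := by
  ext x
  by_cases hx : x ∈ T.closedDomain
  · obtain ⟨K, hK, hxK⟩ := exists_mem_simplex_of_mem_closedDomain hx
    have hcont : ContinuousOn u.1 (simplex K) :=
      u.2.2.1.mono (simplex_subset_closedDomain (mem_elements.1 hK).1)
    have hzero : EqOn u.1 0 (interior (simplex K)) := fun y hy =>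
      eq_zero_of_mem_interior_simplex hd u hjump hbd hK hy
    exact hzero.of_subset_closure hcont continuousOn_const interior_subset
      (closure_interior_simplex hK).ge hxK
  · exact u.2.1 x hx

variable {μ : ℝ} {β : E d → E d} {γ₁ γ₂ : Finset (E d) → ℝ} {k : ℕ}

theorem eqOn_zero_of_faceIntegral_eq_zero (hF : F ∈ T.complex.faces) (hcard : F.card = d)
    {g : E d → ℝ} (hg : ContinuousOn g (simplex F)) (hg0 : ∀ x ∈ simplex F, 0 ≤ g x)
    (h : faceIntegral F g = 0) : EqOn g 0 (simplex F) :=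
  eqOn_zero_of_setIntegral_euclideanHausdorffMeasure_eq_zero (convex_simplex F)
    (isCompact_simplex F) (finrank_vectorSpan_face hF hcard) hg hg0 h

theorem gradJumpProd_self_nonneg (T : Triangulation d) (F : Finset (E d)) (u : E d → ℝ) (x : E d) :
    0 ≤ T.gradJumpProd F u u x :=
  mul_nonneg one_half_pos.le <|
    Finset.sum_nonneg fun _ _ => Finset.sum_nonneg fun _ _ => real_inner_self_nonneg

theorem gradJumpProd_self_eq_zero {u : E d → ℝ} {x : E d} :
    T.gradJumpProd F u u x = 0 ↔
      ∀ K ∈ T.elementsAt F, ∀ K' ∈ T.elementsAt F, gradOn K u x = gradOn K' u x := by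
  have hnonneg (K K' : Finset (E d)) :
      0 ≤ ⟪gradOn K u x - gradOn K' u x, gradOn K u x - gradOn K' u x⟫_ℝ := real_inner_self_nonneg
  rw [gradJumpProd, mul_eq_zero_iff_left one_half_pos.ne',
    Finset.sum_eq_zero_iff_of_nonneg fun K _ => Finset.sum_nonneg fun K' _ => hnonneg K K']
  refine forall₂_congr fun K _ => ?_
  rw [Finset.sum_eq_zero_iff_of_nonneg fun K' _ => hnonneg K K']
  exact forall₂_congr fun K' _ => inner_self_eq_zero.trans sub_eq_zero

theorem diam_pos_of_mem_interiorFaces (hd : 1 < d) (hF : F ∈ T.interiorFaces) : 0 < diam F :=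
  diam_pos_of_one_lt_card (hd.trans_eq (mem_interiorFaces.1 hF).2.1.symm)

theorem scip_feSpace (u v : T.feSpace 1) : T.scip γ₁ γ₂ u v =
    ∑ F ∈ T.interiorFaces, faceIntegral F fun x => diam F * γ₁ F * T.gradJumpProd F u v x := by
  refine Finset.sum_congr rfl fun F _ => faceIntegral_congr fun x hx => ?_
  have hlap (K) (hK : K ∈ T.elementsAt F) : lapOn K v x = 0 :=
    lapOn_feSpace v (mem_elementsAt.1 hK).1 (simplex_subset_of_mem_elementsAt hK hx)
  have hjump : T.lapJumpProd F u v x = 0 := by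
    refine mul_eq_zero_of_right _ <|
      Finset.sum_eq_zero fun K hK => Finset.sum_eq_zero fun K' hK' => ?_
    rw [hlap K hK, hlap K' hK', sub_zero, mul_zero]
  rw [hjump, mul_zero, add_zero]

section Scip

variable (hd : 1 < d) (hγ : ∀ F ∈ T.interiorFaces, 0 < γ₁ F) (u : T.feSpace 1)

include hd hγ

theorem gradJump_integrand_nonneg (hF : F ∈ T.interiorFaces) (x : E d) :
    0 ≤ diam F * γ₁ F * T.gradJumpProd F u u x :=
  mul_nonneg (mul_pos (diam_pos_of_mem_interiorFaces hd hF) (hγ F hF)).le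
    (T.gradJumpProd_self_nonneg F u x)

theorem scip_self_nonneg : 0 ≤ T.scip γ₁ γ₂ u u := by
  rw [scip_feSpace]
  exact Finset.sum_nonneg fun F hF =>
    faceIntegral_nonneg fun x _ => gradJump_integrand_nonneg hd hγ u hF x

theorem gradOn_eq_of_scip_self_eq_zero (h : T.scip γ₁ γ₂ u u = 0) :
    ∀ F ∈ T.interiorFaces, ∀ K ∈ T.elementsAt F, ∀ K' ∈ T.elementsAt F,
      ∀ x ∈ simplex F, gradOn K u x = gradOn K' u x := by
  intro F hF K hK K' hK' x hx
  obtain ⟨hFT, hcard, -⟩ := mem_interiorFaces.1 hF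
  rw [scip_feSpace, Finset.sum_eq_zero_iff_of_nonneg fun F hF =>
    faceIntegral_nonneg fun x _ => gradJump_integrand_nonneg hd hγ u hF x] at h
  let u' : T.piecewiseC2 := ⟨u, T.feSpace_le_piecewiseC2 1 u.2⟩
  have hcont : ContinuousOn (T.gradJumpProd F u u) (simplex F) :=
    (T.gradJumpProd_mem_bilinearFamilies F).2 u' u'
  have hzero := eqOn_zero_of_faceIntegral_eq_zero hFT hcard (continuousOn_const.mul hcont)
    (fun x _ => gradJump_integrand_nonneg hd hγ u hF x) (h F hF) hx
  have hweight := (mul_pos (diam_pos_of_mem_interiorFaces hd hF) (hγ F hF)).ne'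
  exact gradJumpProd_self_eq_zero.1 ((mul_eq_zero_iff_left hweight).1 hzero) K hK K' hK'

end Scip

theorem meshSize_pos (T : Triangulation d) (hd : 0 < d) : 0 < T.meshSize := by
  obtain ⟨s, hs⟩ := T.nonempty
  obtain ⟨K, hK, -⟩ := exists_mem_elements_superset hs
  have hdiam : 0 < diam K := diam_pos_of_one_lt_card (by rw [(mem_elements.1 hK).2]; omega)
  exact hdiam.trans_le (le_csSup (T.elements.finite_toSet.image diam).bddAbove ⟨K, hK, rfl⟩)

theorem boundaryIntegral_weight_self_nonneg {w : Finset (E d) → Finset (E d) → E d → ℝ}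
    (hw : ∀ K F x, 0 ≤ w K F x) (u : E d → ℝ) :
    0 ≤ T.boundaryIntegral fun K F x => w K F x * u x * u x := by
  refine Finset.sum_nonneg fun F _ => Finset.sum_nonneg fun K _ => faceIntegral_nonneg fun x _ => ?_
  exact (mul_nonneg (hw K F x) (mul_self_nonneg (u x))).trans_eq (mul_assoc _ _ _).symm

theorem eqOn_zero_of_boundaryIntegral_mul_self_eq_zero {r : ℝ} (hr : 0 < r) {u : E d → ℝ}
    (hu : ∀ F ∈ T.boundaryFaces, ContinuousOn u (simplex F))
    (h : T.boundaryIntegral (fun _ _ x => r * u x * u x) = 0) (hF : F ∈ T.boundaryFaces) :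
    EqOn u 0 (simplex F) := by
  have hmass (x : E d) : 0 ≤ r * u x * u x := by
    rw [mul_assoc]
    exact mul_nonneg hr.le (mul_self_nonneg _)
  have hint (F : Finset (E d)) : 0 ≤ faceIntegral F fun x => r * u x * u x :=
    faceIntegral_nonneg fun x _ => hmass x
  obtain ⟨hFT, hcard, -⟩ := mem_boundaryFaces.1 hF
  obtain ⟨K, hK⟩ := Finset.card_pos.1 (card_elementsAt_pos hFT)
  rw [boundaryIntegral, Finset.sum_eq_zero_iff_of_nonneg fun F _ =>
    Finset.sum_nonneg fun _ _ => hint F] at h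
  have hintF := (Finset.sum_eq_zero_iff_of_nonneg fun _ _ => hint F).1 (h F hF) K hK
  have hcont : ContinuousOn (fun x => r * u x * u x) (simplex F) :=
    (continuousOn_const.mul (hu F hF)).mul (hu F hF)
  intro x hx
  have hx0 := eqOn_zero_of_faceIntegral_eq_zero hFT hcard hcont (fun x _ => hmass x) hintF hx
  simpa [hr.ne'] using hx0

theorem scip_add_sbc_pos (hd : 1 < d) (hμ : 0 < μ) (hγ : ∀ F ∈ T.interiorFaces, 0 < γ₁ F)
    (σ : ℝ → ℝ) {u : T.feSpace 1} (hu : u ≠ 0) :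
    0 < T.scip γ₁ γ₂ u u + T.sbc σ μ β u u := by
  have hd0 : 0 < d := by omega
  have hweight : 0 < μ * T.meshSize⁻¹ := mul_pos hμ (inv_pos.2 (T.meshSize_pos hd0))
  have hscip : 0 ≤ T.scip γ₁ γ₂ u u := scip_self_nonneg hd hγ u
  have hmass : 0 ≤ T.boundaryIntegral fun _ _ x => μ * T.meshSize⁻¹ * u.1 x * u.1 x :=
    boundaryIntegral_weight_self_nonneg (w := fun _ _ _ => μ * T.meshSize⁻¹)
      (fun _ _ _ => hweight.le) u.1
  have hflux : 0 ≤ T.boundaryIntegral fun K F x => |σ ⟪β x, normal K F⟫_ℝ| * u.1 x * u.1 x :=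
    boundaryIntegral_weight_self_nonneg (w := fun K F x => |σ ⟪β x, normal K F⟫_ℝ|)
      (fun _ _ _ => abs_nonneg _) u.1
  have hsbc : 0 ≤ T.sbc σ μ β u u := add_nonneg hmass hflux
  refine (add_nonneg hscip hsbc).lt_of_ne' fun h => hu ?_
  obtain ⟨hscip0, hsbc0⟩ := (add_eq_zero_iff_of_nonneg hscip hsbc).1 h
  have hmass0 := ((add_eq_zero_iff_of_nonneg hmass hflux).1 hsbc0).1
  have hcont : ∀ F ∈ T.boundaryFaces, ContinuousOn u.1 (simplex F) := fun F hF =>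
    u.2.2.1.mono (simplex_subset_closedDomain (mem_boundaryFaces.1 hF).1)
  exact feSpace_eq_zero_of_gradOn_eq hd0 u (gradOn_eq_of_scip_self_eq_zero hd hγ u hscip0)
    fun F hF => eqOn_zero_of_boundaryIntegral_mul_self_eq_zero hweight hcont hmass0 hF

theorem AdmissibleParameters.gamma_one_pos (hγ : T.AdmissibleParameters μ β γ₁ γ₂) (hμ : 0 < μ)
    (hF : F ∈ T.interiorFaces) : 0 < γ₁ F := by
  obtain ⟨⟨m, _, hm, -, hbounds⟩, -⟩ := hγ
  obtain ⟨K, hK⟩ := Finset.card_pos.1 (card_elementsAt_pos (mem_interiorFaces.1 hF).1)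
  have hsup : 0 ≤ interpNormalSup β F (normal K F) := Real.iSup_nonneg fun _ => abs_nonneg _
  exact (mul_pos hm (add_pos_of_pos_of_nonneg hμ (mul_nonneg hsup (diam_nonneg F)))).trans_le
    (hbounds F hF K hK).1

theorem isLinearMap_load {f : E d → ℝ} (hf : IntegrableOn f T.domain) :
    IsLinearMap ℝ fun w : T.feSpace k => ∫ x in T.domain, f x * w.1 x := by
  have hint (w : T.feSpace k) : IntegrableOn (fun x => f x * w.1 x) T.domain :=
    hf.mul_continuousOn_of_subset w.2.2.1 isOpen_interior.measurableSet T.isCompact_closedDomain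
      interior_subset
  refine ⟨fun v w => ?_, fun r w => ?_⟩
  · rw [← integral_add (hint v) (hint w)]
    exact integral_congr_ae (.of_forall fun x => mul_add _ _ _)
  · rw [← integral_smul]
    exact integral_congr_ae (.of_forall fun x => mul_left_comm _ _ _)

theorem integrableOn_domain_of_memLp {f : E d → ℝ} {p : ENNReal} (hp : 1 ≤ p)
    (hf : MemLp f p (volume.restrict T.domain)) : IntegrableOn f T.domain :=
  have hfin : volume T.domain < ⊤ :=
    (measure_mono interior_subset).trans_lt T.isCompact_closedDomain.measure_lt_top
  have : IsFiniteMeasure (volume.restrict T.domain) := ⟨by rwa [Measure.restrict_apply_univ]⟩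
  hf.integrable hp

/-- The restriction to `X_h^1` of a bilinear form on the piecewise `C²` functions. -/
noncomputable def feForm {b : T.piecewiseC2 → T.piecewiseC2 → ℝ}
    (hb : b ∈ bilinearForms T.piecewiseC2) : T.feSpace 1 →ₗ[ℝ] T.feSpace 1 →ₗ[ℝ] ℝ :=
  hb.toLinearMap.compl₁₂ (Submodule.inclusion (T.feSpace_le_piecewiseC2 1))
    (Submodule.inclusion (T.feSpace_le_piecewiseC2 1))

theorem existsUnique_isFEMSolution (hd : 1 < d) {μ : ℝ} (hμ : 0 < μ) {β : E d → E d}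
    (hβ : ∀ K ∈ T.elements, ContDiffOn ℝ 1 β (simplex K)) {c : E d → ℝ}
    (hc : ∀ K ∈ T.elements, ContinuousOn c (simplex K)) (θ : ℝ) {γ₁ : Finset (E d) → ℝ}
    (hγ : ∀ F ∈ T.interiorFaces, 0 < γ₁ F) (γ₂ : Finset (E d) → ℝ) {f : E d → ℝ}
    (hf : IntegrableOn f T.domain) (ℓ : T.feSpace 1 →ₗ[ℝ] ℝ) :
    ∃! p : T.feSpace 1 × T.feSpace 1, T.IsFEMSolution 1 μ β c θ γ₁ γ₂ f ℓ p.1 p.2 :=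
  have hβ0 : ∀ K ∈ T.elements, ContinuousOn β (simplex K) := fun K hK => (hβ K hK).continuousOn
  existsUnique_primalDual (feForm (ah_mem_bilinearForms hβ hc))
    (P := feForm (sp_mem_bilinearForms hβ0)) (Q := feForm (sa_mem_bilinearForms hβ0))
    (fun _ => scip_add_sbc_pos hd hμ hγ neg) (fun _ => scip_add_sbc_pos hd hμ hγ pos)
    ((isLinearMap_load hf).mk' _) (-ℓ)

end Triangulation

end NonCoerciveFEM

open NonCoerciveFEM MeasureTheory in
theorem mainTheorem11_general {d : ℕ} (hd : 1 < d) (T : Triangulation d) (μ : ℝ) (hμ : 0 < μ)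
    (β : E d → E d) (hβ : ∀ K ∈ T.elements, ContDiffOn ℝ 1 β (simplex K))
    (c : E d → ℝ) (hc : ∀ K ∈ T.elements, ContinuousOn c (simplex K)) (θ : ℝ)
    (γ₁ γ₂ : Finset (E d) → ℝ) (hγ : ∀ F ∈ T.interiorFaces, 0 < γ₁ F)
    (f : E d → ℝ) (hf : IntegrableOn f T.domain) :
    (∀ u : E d → ℝ, (∀ K ∈ T.elements, ContDiffOn ℝ 2 u (simplex K)) →
      ∃! p : T.feSpace 1 × T.feSpace 1,
        T.IsFEMSolution 1 μ β c θ γ₁ γ₂ f (fun vh => T.sp μ β γ₁ γ₂ u vh) p.1 p.2) ∧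
    (∀ ℓ : T.feSpace 1 →ₗ[ℝ] ℝ,
      ∃! p : T.feSpace 1 × T.feSpace 1, T.IsFEMSolution 1 μ β c θ γ₁ γ₂ f ℓ p.1 p.2) := by
  have hsol := T.existsUnique_isFEMSolution hd hμ hβ hc θ hγ γ₂ hf
  have hsp := Triangulation.sp_mem_bilinearForms (T := T) (μ := μ) (γ₁ := γ₁) (γ₂ := γ₂)
    fun K hK => (hβ K hK).continuousOn
  refine ⟨fun u hu => ?_, hsol⟩
  exact hsol (hsp.toLinearMap ⟨u, hu⟩ ∘ₗ Submodule.inclusion (T.feSpace_le_piecewiseC2 1))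

theorem mainTheorem11 (d : ℕ) (hd : d = 2 ∨ d = 3) (T : NonCoerciveFEM.Triangulation d)
    (μ : ℝ) (hμ : 0 < μ)
    (β : NonCoerciveFEM.E d → NonCoerciveFEM.E d) (hβ : ContDiffOn ℝ 2 β T.closedDomain)
    (c : NonCoerciveFEM.E d → ℝ) (hc : ContDiffOn ℝ 1 c T.closedDomain)
    (θ : ℝ)
    (γ₁ γ₂ : Finset (NonCoerciveFEM.E d) → ℝ) (hγ : T.AdmissibleParameters μ β γ₁ γ₂)
    (f : NonCoerciveFEM.E d → ℝ)
    (hf : MeasureTheory.MemLp f 2 (MeasureTheory.volume.restrict T.domain)) :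
    (∀ u : NonCoerciveFEM.E d → ℝ,
      (∀ K ∈ T.elements, ContDiffOn ℝ 2 u (NonCoerciveFEM.simplex K)) →
      ∃! p : T.feSpace 1 × T.feSpace 1,
        T.IsFEMSolution 1 μ β c θ γ₁ γ₂ f (fun vh => T.sp μ β γ₁ γ₂ u vh) p.1 p.2) ∧
    (∀ ℓ : T.feSpace 1 →ₗ[ℝ] ℝ,
      ∃! p : T.feSpace 1 × T.feSpace 1,
        T.IsFEMSolution 1 μ β c θ γ₁ γ₂ f ℓ p.1 p.2) := by
  refine mainTheorem11_general (by omega) T μ hμ β (fun K hK => ?_) c (fun K hK => ?_) θ γ₁ γ₂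
    (fun F hF => hγ.gamma_one_pos hμ hF) f (T.integrableOn_domain_of_memLp one_le_two hf)
  · exact (hβ.of_le one_le_two).mono (T.simplex_subset_closedDomain (T.mem_elements.1 hK).1)
  · exact hc.continuousOn.mono (T.simplex_subset_closedDomain (T.mem_elements.1 hK).1)
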